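/- Let $\mathbb K\in\{\mathbb R,\mathbb C\}$ and $r\ge 2$. For a partition $\mu\vdash n$ let $[\mu]$ denote the equivalence class of the representation of $S_n$ by left multiplication on the left ideal $\mathbb K[S_n]\,y_t$, where $t$ is any Young tableau of frame $\mu$ and $y_t=\sum_{p\in H_t}\sum_{q\in V_t}\operatorname{sign}(q)\,p\,q$ is its Young symmetrizer ($H_t$, $V_t$ being the groups of horizontal and vertical permutations of $t$). For $\mu\vdash m$ and $\nu\vdash n$ let $[\mu][\nu]$ be the Littlewood–Richardson product, i.e. the class of the outer tensor product of $[\mu]$ and $[\nu]$ induced from $S_m\times S_n$ to $S_{m+n}$. A left ideal of $\mathbb K[S_n]$ is regarded as a representation of $S_n$ by left multiplication. Put $\tilde S_r=\{p\in S_{r+1}: p(r+1)=r+1\}$ and, in $\mathbb K[S_{r+1}]$, $$e_s=\frac1{r!}\sum_{p\in\tilde S_r}p,\quad e_a=\frac1{r!}\sum_{p\in\tilde S_r}\operatorname{sign}(p)\,p,\quad f_s=\frac1{(r+1)!}\sum_{p\in S_{r+1}}p,\quad f_a=\frac1{(r+1)!}\sum_{p\in S_{r+1}}\operatorname{sign}(p)\,p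 .$$ Theorem. (1) The representations on the left ideals $\mathbb K[S_{r+1}]e_s$ and $\mathbb K[S_{r+1}]e_a$ are equivalent to $[r][1]$ and $[1^r][1]$ respectively, and $$[r][1]\sim[r+1]+[r,1],\qquad [1^r][1]\sim[1^{r+1}]+[2,1^{r-1}].$$ (2) There are elements $h_s,h_a\in\mathbb K[S_{r+1}]$ such that $e_s=f_s+h_s$ and $e_a=f_a+h_a$ are decompositions into primitive orthogonal idempotents. The left ideals generated by $f_s,h_s,f_a,h_a$ are minimal and carry the representations $[r+1]$, $[r,1]$, $[1^{r+1}]$, $[2,1^{r-1}]$ respectively. (3) These decompositions are unique: if $e_s=f+h$ with $f,h$ primitive orthogonal idempotents such that $\mathbb K[S_{r+1}]f$ and $\mathbb K[S_{r+1}]h$ carry $[r+1]$ and $[r,1]$ respectively, then $f=f_s$ and $h=h_s$; and likewise for $e_a=f+h$ with $[1^{r+1}]$ and $[2,1^{r-1}]$, where $f=f_a$ and $h=h_a$. Moreover, any finite set of pairwise orthogonal primitive idempotents with sum $e_s$ (respectively $e_a$) is equal to $\{f_s,h_s\}$ (respectively $\{f_a,h_a\}$). -/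

import Mathlib

open scoped BigOperators

noncomputable section

namespace SymClass

/-- The group ring `𝕜[S_n]`, where `S_n` is the group of permutations of `Fin n`. -/
abbrev GroupRing (𝕜 : Type*) [RCLike 𝕜] (n : ℕ) : Type _ :=
  MonoidAlgebra 𝕜 (Equiv.Perm (Fin n))

/-- A group element, regarded as an element of the group ring. -/
abbrev grp (𝕜 : Type*) [RCLike 𝕜] {n : ℕ} (p : Equiv.Perm (Fin n)) : GroupRing 𝕜 n :=
  MonoidAlgebra.of 𝕜 (Equiv.Perm (Fin n)) p

/-- The sign of a permutation, as a scalar. -/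
abbrev sgn (𝕜 : Type*) [RCLike 𝕜] {n : ℕ} (p : Equiv.Perm (Fin n)) : 𝕜 :=
  ((Equiv.Perm.sign p : ℤ) : 𝕜)

/-! ### Partitions, Young frames and Young tableaux -/

/-- The Young frame of a partition, rows of weakly decreasing length. -/
def frame {n : ℕ} (μ : n.Partition) : YoungDiagram :=
  YoungDiagram.ofRowLens (μ.parts.sort (· ≥ ·)) (Multiset.pairwise_sort _ _).sortedGE

theorem card_cellsOfRowLens (w : List ℕ) : (YoungDiagram.cellsOfRowLens w).card = w.sum := by
  induction w with
  | nil => simp [YoungDiagram.cellsOfRowLens]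
  | cons a w ih =>
    rw [YoungDiagram.cellsOfRowLens, Finset.card_union_of_disjoint]
    · simp [ih]
    · rw [Finset.disjoint_left]
      rintro ⟨i, j⟩ h1 h2
      simp at h1 h2
      omega

theorem card_frame {n : ℕ} (μ : n.Partition) : (frame μ).card = n := by
  have h : (frame μ).card = (μ.parts.sort (· ≥ ·)).sum := card_cellsOfRowLens _
  rw [h, ← Multiset.sum_coe, Multiset.sort_eq, μ.parts_sum]

/-- A Young tableau of frame `μ ⊢ n`: a filling of the boxes of the frame with the elements of
`Fin n`, each used exactly once. -/
abbrev Tableau {n : ℕ} (μ : n.Partition) : Type :=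
  {c : ℕ × ℕ // c ∈ (frame μ).cells} ≃ Fin n

instance {n : ℕ} (μ : n.Partition) : Nonempty (Tableau μ) :=
  ⟨Fintype.equivFinOfCardEq (by rw [Fintype.card_coe]; exact card_frame μ)⟩

/-- `p` is a horizontal permutation of the tableau `t`: it maps every entry to an entry of the
same row. -/
def IsHorizontal {n : ℕ} {μ : n.Partition} (t : Tableau μ) (p : Equiv.Perm (Fin n)) : Prop :=
  ∀ i : Fin n, (t.symm (p i)).1.1 = (t.symm i).1.1

/-- `q` is a vertical permutation of the tableau `t`: it maps every entry to an entry of the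
same column. -/
def IsVertical {n : ℕ} {μ : n.Partition} (t : Tableau μ) (q : Equiv.Perm (Fin n)) : Prop :=
  ∀ i : Fin n, (t.symm (q i)).1.2 = (t.symm i).1.2

open Classical in
/-- The Young symmetrizer `y_t = ∑_{p horizontal} ∑_{q vertical} sign(q) p q`. -/
def youngSymmetrizer (𝕜 : Type*) [RCLike 𝕜] {n : ℕ} {μ : n.Partition} (t : Tableau μ) :
    GroupRing 𝕜 n :=
  ∑ p : Equiv.Perm (Fin n) with IsHorizontal t p,
    ∑ q : Equiv.Perm (Fin n) with IsVertical t q, sgn 𝕜 q • grp 𝕜 (p * q)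

/-! ### Left ideals as representations, and the classes `[μ]` -/

/-- The left ideal `𝕜[S_n] · a` (`Ideal` in a noncommutative ring means left ideal). -/
abbrev leftIdeal {𝕜 : Type*} [RCLike 𝕜] {n : ℕ} (a : GroupRing 𝕜 n) : Ideal (GroupRing 𝕜 n) :=
  Ideal.span {a}

theorem leftIdeal_invariant {𝕜 : Type*} [RCLike 𝕜] {n : ℕ} (I : Ideal (GroupRing 𝕜 n))
    (g : Equiv.Perm (Fin n)) :
    I.restrictScalars 𝕜 ≤
      (I.restrictScalars 𝕜).comap (Representation.leftRegular 𝕜 (Equiv.Perm (Fin n)) g) := by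
  intro x hx
  have h : Representation.leftRegular 𝕜 (Equiv.Perm (Fin n)) g x = grp 𝕜 g * x := by
    rw [← Representation.asAlgebraHom_ofMulAction_smul_eq_mul, Representation.asAlgebraHom_of]
  rw [Submodule.mem_comap, h]
  exact I.mul_mem_left _ hx

/-- The subrepresentation of the left regular representation of `S_n` on a left ideal. -/
def idealRep {𝕜 : Type*} [RCLike 𝕜] {n : ℕ} (I : Ideal (GroupRing 𝕜 n)) :
    Representation 𝕜 (Equiv.Perm (Fin n)) (I.restrictScalars 𝕜) :=
  (Representation.leftRegular 𝕜 (Equiv.Perm (Fin n))).subrepresentation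
    (I.restrictScalars 𝕜) (leftIdeal_invariant I)

/-- The representation of `S_n` on `𝕜[S_n] · y_t`, whose equivalence class is `[μ]` for every
tableau `t` of frame `μ`. -/
abbrev youngRep (𝕜 : Type*) [RCLike 𝕜] {n : ℕ} {μ : n.Partition} (t : Tableau μ) :
    Representation 𝕜 (Equiv.Perm (Fin n))
      ((leftIdeal (youngSymmetrizer 𝕜 t)).restrictScalars 𝕜) :=
  idealRep (leftIdeal (youngSymmetrizer 𝕜 t))

/-- The embedding `S_m × S_n → S_{m+n}` of the Young subgroup. -/
def youngSubgroupHom (m n : ℕ) :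
    Equiv.Perm (Fin m) × Equiv.Perm (Fin n) →* Equiv.Perm (Fin (m + n)) :=
  (finSumFinEquiv (m := m) (n := n)).permCongrHom.toMonoidHom.comp
    (Equiv.Perm.sumCongrHom (Fin m) (Fin n))

/-- The Littlewood-Richardson product of a representation of `S_m` and a representation of `S_n`:
their outer tensor product, induced from `S_m × S_n` to `S_{m+n}`. -/
abbrev lrProduct {𝕜 : Type*} [RCLike 𝕜] {m n : ℕ} {V W : Type*}
    [AddCommGroup V] [Module 𝕜 V] [AddCommGroup W] [Module 𝕜 W]
    (ρ : Representation 𝕜 (Equiv.Perm (Fin m)) V) (σ : Representation 𝕜 (Equiv.Perm (Fin n)) W) :=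
  Representation.ind (youngSubgroupHom m n)
    (Representation.tprod (ρ.comp (MonoidHom.fst _ _)) (σ.comp (MonoidHom.snd _ _)))

/-- `ρ ∼ [μ]`. -/
def Affords {𝕜 : Type*} [RCLike 𝕜] {n : ℕ} {V : Type*} [AddCommGroup V] [Module 𝕜 V]
    (ρ : Representation 𝕜 (Equiv.Perm (Fin n)) V) (μ : n.Partition) : Prop :=
  ∀ t : Tableau μ, Nonempty (ρ.Equiv (youngRep 𝕜 t))

/-- `ρ ∼ [μ] + [ν]`. -/
def AffordsSum {𝕜 : Type*} [RCLike 𝕜] {n : ℕ} {V : Type*} [AddCommGroup V] [Module 𝕜 V]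
    (ρ : Representation 𝕜 (Equiv.Perm (Fin n)) V) (μ ν : n.Partition) : Prop :=
  ∀ (t : Tableau μ) (u : Tableau ν), Nonempty (ρ.Equiv ((youngRep 𝕜 t).prod (youngRep 𝕜 u)))

/-- `ρ ∼ [μ][ν]`. -/
def AffordsProduct {𝕜 : Type*} [RCLike 𝕜] {m n : ℕ} {V : Type*} [AddCommGroup V] [Module 𝕜 V]
    (ρ : Representation 𝕜 (Equiv.Perm (Fin (m + n))) V)
    (μ : m.Partition) (ν : n.Partition) : Prop :=
  ∀ (t : Tableau μ) (u : Tableau ν),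
    Nonempty (ρ.Equiv (lrProduct (youngRep 𝕜 t) (youngRep 𝕜 u)))

/-- `[μ][ν] ∼ [α] + [β]`. -/
def ProductDecomposes (𝕜 : Type*) [RCLike 𝕜] {m n : ℕ} (μ : m.Partition) (ν : n.Partition)
    (α β : (m + n).Partition) : Prop :=
  ∀ (t : Tableau μ) (u : Tableau ν),
    AffordsSum (lrProduct (youngRep 𝕜 t) (youngRep 𝕜 u)) α β

/-! ### The partitions `(n)`, `(1^n)`, `(r, 1)` and `(2, 1^{r-1})` -/

/-- `(n) ⊢ n`. -/
def rowPartition (n : ℕ) : n.Partition := Nat.Partition.ofSums n {n} (by simp)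

/-- `(1^n) ⊢ n`. -/
def colPartition (n : ℕ) : n.Partition :=
  Nat.Partition.ofSums n (Multiset.replicate n 1) (by simp)

/-- `(r, 1) ⊢ r + 1`. -/
def rowHook (r : ℕ) : (r + 1).Partition := Nat.Partition.ofSums (r + 1) {r, 1} (by simp)

/-- `(2, 1^{r-1}) ⊢ r + 1`, for `r ≥ 1`. -/
def colHook (r : ℕ) (hr : 1 ≤ r) : (r + 1).Partition :=
  Nat.Partition.ofSums (r + 1) (2 ::ₘ Multiset.replicate (r - 1) 1) (by simp; omega)

/-! ### Idempotents -/

/-- A primitive idempotent: a nonzero idempotent that is not the sum of two nonzero orthogonal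
idempotents. -/
def IsPrimitiveIdempotent {A : Type*} [Ring A] (e : A) : Prop :=
  e ≠ 0 ∧ IsIdempotentElem e ∧
    ∀ a b : A, IsIdempotentElem a → IsIdempotentElem b → a * b = 0 → b * a = 0 → e = a + b →
      a = 0 ∨ b = 0

/-- `e = f + h` is a decomposition into primitive orthogonal idempotents, with the left ideal of
`f` affording `[μ]` and the left ideal of `h` affording `[ν]`. -/
structure IsDecomposition {𝕜 : Type*} [RCLike 𝕜] {n : ℕ} (e f h : GroupRing 𝕜 n)
    (μ ν : n.Partition) : Prop where
  primitive_left : IsPrimitiveIdempotent f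
  primitive_right : IsPrimitiveIdempotent h
  mul_eq_zero : f * h = 0
  mul_eq_zero' : h * f = 0
  eq_add : e = f + h
  affords_left : Affords (idealRep (leftIdeal f)) μ
  affords_right : Affords (idealRep (leftIdeal h)) ν

/-- The idempotent `e` is, up to the order of the summands, in only one way a sum of pairwise
orthogonal primitive idempotents, namely as the sum of the elements of `{f, h}`. -/
def OnlyPrimitiveDecomposition {A : Type*} [Ring A] (e f h : A) : Prop :=
  ∀ s : Finset A, (∀ x ∈ s, IsPrimitiveIdempotent x) →
    (∀ x ∈ s, ∀ y ∈ s, x ≠ y → x * y = 0) → ∑ x ∈ s, x = e → (s : Set A) = {f, h}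

/-- `e_s`: the symmetrizer over the subgroup of `S_{r+1}` fixing the last point. -/
def eSym (𝕜 : Type*) [RCLike 𝕜] (r : ℕ) : GroupRing 𝕜 (r + 1) :=
  ((r.factorial : 𝕜)⁻¹) •
    ∑ p : Equiv.Perm (Fin (r + 1)) with p (Fin.last r) = Fin.last r, grp 𝕜 p

/-- `e_a`: the antisymmetrizer over the subgroup of `S_{r+1}` fixing the last point. -/
def eAlt (𝕜 : Type*) [RCLike 𝕜] (r : ℕ) : GroupRing 𝕜 (r + 1) :=
  ((r.factorial : 𝕜)⁻¹) •
    ∑ p : Equiv.Perm (Fin (r + 1)) with p (Fin.last r) = Fin.last r, sgn 𝕜 p • grp 𝕜 p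

/-- `f_s`: the full symmetrizer of `S_{r+1}`. -/
def fSym (𝕜 : Type*) [RCLike 𝕜] (r : ℕ) : GroupRing 𝕜 (r + 1) :=
  (((r + 1).factorial : 𝕜)⁻¹) • ∑ p : Equiv.Perm (Fin (r + 1)), grp 𝕜 p

/-- `f_a`: the full antisymmetrizer of `S_{r+1}`. -/
def fAlt (𝕜 : Type*) [RCLike 𝕜] (r : ℕ) : GroupRing 𝕜 (r + 1) :=
  (((r + 1).factorial : 𝕜)⁻¹) • ∑ p : Equiv.Perm (Fin (r + 1)), sgn 𝕜 p • grp 𝕜 p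

end SymClass

end

/-!
Let `H` be the subgroup of `S_{r+1}` fixing the last point, let `χ` be the trivial character or the
sign, and let `e` and `f` be the idempotents of `χ` on `H` and on `S_{r+1}`. Everything rests on the
corner ring `e A e` of the group ring `A`. Since `S_{r+1}` is doubly transitive, the complement of
`H` is a single double coset, so the elements `χ(g) e g e` with `g ∉ H` coincide, and averaging over
the whole group expresses them through `e` and `f` (`exists_corner_eq`). Hence `e A e` is `k f + k h`
with `h = e - f` (`splitsCorner_charIdem`), a ring isomorphic to `k × k`, whose only idempotents are
`0`, `f`, `h` and `e`. This makes `f` and `h` primitive, and it makes `e = f + h` the only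
decomposition of `e` into primitive orthogonal idempotents. The ideals `A f` and `A h` are minimal
because `A` is semisimple (`IsPrimitiveIdempotent.isAtom_span`). The roles of `f` and `h` cannot be
exchanged, because `S_{r+1}` acts on `A f` through `χ` and `χ` does not occur in `A h`, as `f h = 0`
(`decomposition_charIdem`).

The representations are identified through Young symmetrizers. If `A h` is minimal and a nonzero
`y_t` has the form `w z` with `w ∈ A h`, then right multiplication by `z` is an isomorphism from
`A h` to `A y_t` (`nonempty_linearEquiv_span_mul`). For a row or a column, `y_t` is a multiple of `f`.
For the hook `(r, 1)` it is a multiple of `g e g⁻¹ (1 - (a b))`, where `g` carries the last point to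
`b`; the factor `1 - (a b)` annihilates `f`, so `e` may be replaced by `h`
(`exists_rowHook_factor`). For `(2, 1^{r-1})` the same happens with `(1 + (a b)) g e g⁻¹`
(`exists_colHook_factor`).

Finally, the outer tensor product of `[r]` or `[1^r]` with `[1]` is one-dimensional and is the
restriction of `χ` to `S_r × S_1`, whose image in `S_{r+1}` is `H`; inducing it gives `A e`
(`nonempty_equiv_ind`).
-/

namespace SymClass

/-! ### Idempotents whose corner ring is split of dimension two -/

/-- The idempotent `e` is the sum of the nonzero orthogonal idempotents `f` and `h`, and the corner
ring `e A e` is spanned by `f` and `h` over `k`; thus `e A e` is isomorphic to `k × k`. -/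
structure SplitsCorner (k : Type*) {A : Type*} [Field k] [Ring A] [Algebra k A] (e f h : A) :
    Prop where
  idem_left : f * f = f
  idem_right : h * h = h
  mul_eq_zero : f * h = 0
  mul_eq_zero' : h * f = 0
  left_ne_zero : f ≠ 0
  right_ne_zero : h ≠ 0
  eq_add : e = f + h
  corner : ∀ x : A, ∃ a b : k, e * x * e = a • f + b • h

namespace SplitsCorner

variable {k A : Type*} [Field k] [Ring A] [Algebra k A] {e f h : A}

theorem symm (H : SplitsCorner k e f h) : SplitsCorner k e h f where
  idem_left := H.idem_right
  idem_right := H.idem_left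
  mul_eq_zero := H.mul_eq_zero'
  mul_eq_zero' := H.mul_eq_zero
  left_ne_zero := H.right_ne_zero
  right_ne_zero := H.left_ne_zero
  eq_add := by rw [H.eq_add, add_comm]
  corner x := by
    obtain ⟨a, b, hx⟩ := H.corner x
    exact ⟨b, a, by rw [hx, add_comm]⟩

theorem mul_left (H : SplitsCorner k e f h) : e * f = f := by
  rw [H.eq_add, add_mul, H.idem_left, H.mul_eq_zero', add_zero]

theorem left_mul (H : SplitsCorner k e f h) : f * e = f := by
  rw [H.eq_add, mul_add, H.idem_left, H.mul_eq_zero, add_zero]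

/-- An idempotent of `k × k` has coordinates `0` or `1`. -/
theorem eq_of_idem (H : SplitsCorner k e f h) {x : A} (hx : x * x = x) (hex : e * x = x)
    (hxe : x * e = x) : x = 0 ∨ x = f ∨ x = h ∨ x = e := by
  obtain ⟨a, b, hab⟩ := H.corner x
  rw [hex, hxe] at hab
  have hf : x * f = a • f := by
    rw [hab, add_mul, smul_mul_assoc, smul_mul_assoc, H.idem_left, H.mul_eq_zero', smul_zero,
      add_zero]
  have hh : x * h = b • h := by
    rw [hab, add_mul, smul_mul_assoc, smul_mul_assoc, H.idem_right, H.mul_eq_zero, smul_zero,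
      zero_add]
  have key : ∀ (c : k) (g : A), g ≠ 0 → x * g = c • g → c = 0 ∨ c = 1 := by
    intro c g hg hc
    have h1 : (c * c) • g = c • g := by
      rw [mul_smul, ← hc, ← mul_smul_comm, ← hc, ← mul_assoc, hx]
    have h2 : c * c = c := smul_left_injective k hg h1
    exact IsIdempotentElem.iff_eq_zero_or_one.1 h2
  rcases key a f H.left_ne_zero hf with rfl | rfl <;>
    rcases key b h H.right_ne_zero hh with rfl | rfl
  · left; simpa using hab
  · right; right; left; simpa using hab
  · right; left; simpa using hab
  · right; right; right; rw [H.eq_add]; simpa using hab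

theorem primitive_left (H : SplitsCorner k e f h) : IsPrimitiveIdempotent f := by
  refine ⟨H.left_ne_zero, H.idem_left, fun a b ha hb hab hba hf => ?_⟩
  have hfa : f * a = a := by rw [hf, add_mul, ha.eq, hba, add_zero]
  have haf : a * f = a := by rw [hf, mul_add, ha.eq, hab, add_zero]
  have hea : e * a = a := by rw [← hfa, ← mul_assoc, H.mul_left]
  have hae : a * e = a := by rw [← haf, mul_assoc, H.left_mul]
  have hb' : b = f - a := by rw [hf, add_sub_cancel_left]
  rcases H.eq_of_idem ha hea hae with rfl | rfl | rfl | rfl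
  · exact Or.inl rfl
  · exact Or.inr (by rw [hb', sub_self])
  · exact absurd (haf.symm.trans H.mul_eq_zero') H.right_ne_zero
  · exact Or.inr (by rw [hb', ← haf, H.mul_left, sub_self])

theorem primitive_right (H : SplitsCorner k e f h) : IsPrimitiveIdempotent h :=
  H.symm.primitive_left

theorem eq_of_primitive (H : SplitsCorner k e f h) {x : A} (hx : IsPrimitiveIdempotent x)
    (hex : e * x = x) (hxe : x * e = x) : x = f ∨ x = h := by
  rcases H.eq_of_idem hx.2.1 hex hxe with h0 | h0 | h0 | h0
  · exact absurd h0 hx.1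
  · exact Or.inl h0
  · exact Or.inr h0
  · exact ((hx.2.2 f h H.idem_left H.idem_right H.mul_eq_zero H.mul_eq_zero'
      (h0.trans H.eq_add)).elim H.left_ne_zero H.right_ne_zero).elim

theorem onlyPrimitiveDecomposition (H : SplitsCorner k e f h) :
    OnlyPrimitiveDecomposition e f h := by
  intro s hs horth hsum
  have hsub : ∀ x ∈ s, x = f ∨ x = h := by
    intro x hx
    refine H.eq_of_primitive (hs x hx) ?_ ?_
    · rw [← hsum, Finset.sum_mul, Finset.sum_eq_single_of_mem x hx
        (fun y hy hyx => horth y hy x hx hyx), (hs x hx).2.1.eq]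
    · rw [← hsum, Finset.mul_sum, Finset.sum_eq_single_of_mem x hx
        (fun y hy hyx => horth x hx y hy hyx.symm), (hs x hx).2.1.eq]
  -- If one of the two were missing from `s`, multiplying the sum by it would give zero.
  have hmem : ∀ f h : A, SplitsCorner k e f h → (∀ x ∈ s, x = f ∨ x = h) → f ∈ s := by
    intro f h H hsub
    by_contra hf
    apply H.left_ne_zero
    rw [← H.mul_left, ← hsum, Finset.sum_mul]
    refine Finset.sum_eq_zero fun x hx => ?_
    rcases hsub x hx with rfl | rfl
    · exact absurd hx hf
    · exact H.mul_eq_zero'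
  ext x
  simp only [Finset.mem_coe, Set.mem_insert_iff, Set.mem_singleton_iff]
  refine ⟨hsub x, ?_⟩
  rintro (rfl | rfl)
  · exact hmem _ _ H hsub
  · exact hmem _ _ H.symm fun x hx => (hsub x hx).symm

end SplitsCorner

/-! ### Minimal left ideals -/

theorem mul_right_eq_self_of_mem_span {A : Type*} [Ring A] {f x : A} (hf : f * f = f)
    (hx : x ∈ Ideal.span {f}) : x * f = x := by
  obtain ⟨a, rfl⟩ := Ideal.mem_span_singleton'.1 hx
  rw [mul_assoc, hf]

/-- A left ideal `I` inside `A f` has a complement in `A`, along which `f` splits into two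
orthogonal idempotents. -/
theorem IsPrimitiveIdempotent.isAtom_span {A : Type*} [Ring A] [IsSemisimpleRing A] {f : A}
    (hf : IsPrimitiveIdempotent f) : IsAtom (Ideal.span {f}) := by
  obtain ⟨hf0, hff, hprim⟩ := hf
  refine ⟨by simpa [Ideal.span_singleton_eq_bot] using hf0, fun I hI => ?_⟩
  obtain ⟨J, hJ⟩ := exists_isCompl I
  have htop : f ∈ I ⊔ J := by rw [hJ.sup_eq_top]; trivial
  obtain ⟨i, hi, j, hj, hij⟩ := Submodule.mem_sup.1 htop
  have hdisj : ∀ x, x ∈ I → x ∈ J → x = 0 := fun x h1 h2 => by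
    have : x ∈ I ⊓ J := ⟨h1, h2⟩
    rwa [hJ.inf_eq_bot] at this
  have hif : i * f = i := mul_right_eq_self_of_mem_span hff.eq (hI.le hi)
  have hjf : j * f = j := by
    have : j = f - i := by rw [← hij, add_sub_cancel_left]
    rw [this, sub_mul, hff.eq, hif]
  have hij0 : i * j = 0 := by
    refine hdisj _ ?_ (J.mul_mem_left _ hj)
    have : i * j = i - i * i := by rw [eq_sub_iff_add_eq, add_comm, ← mul_add, hij, hif]
    rw [this]
    exact I.sub_mem hi (I.mul_mem_left _ hi)
  have hji0 : j * i = 0 := by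
    refine hdisj _ (I.mul_mem_left _ hi) ?_
    have : j * i = j - j * j := by rw [eq_sub_iff_add_eq, ← mul_add, hij, hjf]
    rw [this]
    exact J.sub_mem hj (J.mul_mem_left _ hj)
  have hii : i * i = i := by rw [← hij, mul_add, hij0, add_zero] at hif; exact hif
  have hjj : j * j = j := by rw [← hij, mul_add, hji0, zero_add] at hjf; exact hjf
  rcases hprim i j hii hjj hij0 hji0 hij.symm with rfl | rfl
  · rw [zero_add] at hij
    subst hij
    refine (Submodule.eq_bot_iff _).2 fun x hx => hdisj x hx ?_
    rw [← mul_right_eq_self_of_mem_span hff.eq (hI.le hx)]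
    exact J.mul_mem_left _ hj
  · rw [add_zero] at hij
    subst hij
    exact absurd (le_antisymm hI.le ((Ideal.span_singleton_le_iff_mem _).2 hi)) hI.ne

/-- Right multiplication by `z` is injective on a minimal left ideal that it does not kill, and its
image is again a minimal left ideal. -/
theorem nonempty_linearEquiv_span_mul {A : Type*} [Ring A] {h w z : A}
    (hh : IsAtom (Ideal.span {h})) (hw : w ∈ Ideal.span {h}) (hwz : w * z ≠ 0) :
    Nonempty (Ideal.span {h} ≃ₗ[A] Ideal.span {w * z}) := by
  have hspan : Ideal.span {w} = Ideal.span {h} := by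
    refine (hh.le_iff.1 ((Ideal.span_singleton_le_iff_mem _).2 hw)).resolve_left fun h0 => ?_
    rw [Ideal.span_singleton_eq_bot] at h0
    exact hwz (by rw [h0, zero_mul])
  have hsimple : IsSimpleModule A (Ideal.span {h}) := isSimpleModule_iff_isAtom.2 hh
  let F : Ideal.span {h} →ₗ[A] A := (LinearMap.toSpanSingleton A A z).domRestrict (Ideal.span {h})
  have hF : ∀ v : Ideal.span {h}, F v = v * z := fun v => rfl
  have hinj : Function.Injective F := by
    refine F.injective_or_eq_zero.resolve_right fun h0 => hwz ?_
    have := hF ⟨w, hw⟩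
    rw [h0] at this
    exact this.symm
  have hrange : LinearMap.range F = Ideal.span {w * z} := by
    ext x
    rw [LinearMap.mem_range, Ideal.mem_span_singleton']
    constructor
    · rintro ⟨⟨v, hv⟩, rfl⟩
      rw [← hspan] at hv
      obtain ⟨a, rfl⟩ := Ideal.mem_span_singleton'.1 hv
      exact ⟨a, by rw [hF, mul_assoc]⟩
    · rintro ⟨a, rfl⟩
      exact ⟨⟨a * w, Ideal.mul_mem_left _ _ hw⟩, by rw [hF, mul_assoc]⟩
  exact ⟨(LinearEquiv.ofInjective F hinj).trans (LinearEquiv.ofEq _ _ hrange)⟩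

end SymClass

namespace SymClass

/-! ### The idempotent of a sign character of a subgroup -/

open Classical in
/-- The idempotent `|S|⁻¹ ∑_{p ∈ S} χ(p) p` attached to the restriction to the subgroup `S` of a
character `χ` with values `±1`. As `χ = χ⁻¹`, each `p ∈ S` acts on it as the scalar `χ(p)`. -/
noncomputable def charIdem (k : Type*) {G : Type*} [Field k] [Group G] [Fintype G] (χ : G →* ℤˣ)
    (S : Subgroup G) : MonoidAlgebra k G :=
  (Nat.card S : k)⁻¹ • ∑ p : G with p ∈ S, ((χ p : ℤ) : k) • MonoidAlgebra.of k G p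

section

variable {k G : Type*} [Field k] [Group G] (χ : G →* ℤˣ)

theorem character_smul_smul {M : Type*} [AddCommGroup M] [Module k M] (g : G) (x : M) :
    ((χ g : ℤ) : k) • ((χ g : ℤ) : k) • x = x := by
  rw [smul_smul, ← Int.cast_mul, ← Units.val_mul, Int.units_mul_self, Units.val_one, Int.cast_one,
    one_smul]

theorem character_inv (g : G) : χ g⁻¹ = χ g := by
  rw [map_inv, Int.units_inv_eq_self]

variable [Fintype G] {S T : Subgroup G}

open Classical in
theorem card_filter_mem (S : Subgroup G) :
    (Finset.univ.filter (fun p => p ∈ S)).card = Nat.card S := by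
  rw [Nat.card_eq_fintype_card, Fintype.card_subtype]

open Classical in
theorem of_mul_charIdem {g : G} (hg : g ∈ S) :
    MonoidAlgebra.of k G g * charIdem k χ S = ((χ g : ℤ) : k) • charIdem k χ S := by
  rw [charIdem, mul_smul_comm, smul_comm ((χ g : ℤ) : k)]
  congr 1
  rw [Finset.mul_sum, Finset.smul_sum]
  refine Finset.sum_equiv (Equiv.mulLeft g) (fun p => ?_) (fun p _ => ?_)
  · simp [S.mul_mem_cancel_left hg]
  · rw [Equiv.coe_mulLeft, map_mul, map_mul, Units.val_mul, Int.cast_mul, mul_smul,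
      character_smul_smul, mul_smul_comm]

open Classical in
theorem charIdem_mul_of {g : G} (hg : g ∈ S) :
    charIdem k χ S * MonoidAlgebra.of k G g = ((χ g : ℤ) : k) • charIdem k χ S := by
  rw [charIdem, smul_mul_assoc, smul_comm ((χ g : ℤ) : k)]
  congr 1
  rw [Finset.sum_mul, Finset.smul_sum]
  refine Finset.sum_equiv (Equiv.mulRight g) (fun p => ?_) (fun p _ => ?_)
  · simp [S.mul_mem_cancel_right hg]
  · rw [Equiv.coe_mulRight, map_mul, map_mul, mul_comm (χ p), Units.val_mul, Int.cast_mul, mul_smul,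
      character_smul_smul, smul_mul_assoc]

open Classical in
theorem charIdem_apply (g : G) :
    (charIdem k χ S).coeff g = if g ∈ S then (Nat.card S : k)⁻¹ * ((χ g : ℤ) : k) else 0 := by
  simp only [charIdem, MonoidAlgebra.of_apply, MonoidAlgebra.coeff_smul, MonoidAlgebra.coeff_sum,
    MonoidAlgebra.coeff_single, Finsupp.smul_apply, Finsupp.finsetSum_apply, Finsupp.single_apply,
    smul_eq_mul, mul_ite, mul_one, mul_zero, Finset.sum_ite_eq', Finset.mem_filter,
    Finset.mem_univ, true_and]

variable [CharZero k]

theorem card_subgroup_ne_zero (S : Subgroup G) : (Nat.card S : k) ≠ 0 :=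
  Nat.cast_ne_zero.2 Nat.card_pos.ne'

open Classical in
/-- An element on which `S` acts by `χ` is fixed by the idempotent. -/
theorem charIdem_mul_eq {x : MonoidAlgebra k G}
    (hx : ∀ g ∈ S, MonoidAlgebra.of k G g * x = ((χ g : ℤ) : k) • x) : charIdem k χ S * x = x := by
  rw [charIdem, smul_mul_assoc, Finset.sum_mul, Finset.sum_congr rfl (g := fun _ => x),
    Finset.sum_const, card_filter_mem, ← Nat.cast_smul_eq_nsmul k,
    inv_smul_smul₀ (card_subgroup_ne_zero S)]
  intro p hp
  rw [smul_mul_assoc, hx p (by simpa using hp), character_smul_smul]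

open Classical in
theorem mul_charIdem_eq {x : MonoidAlgebra k G}
    (hx : ∀ g ∈ S, x * MonoidAlgebra.of k G g = ((χ g : ℤ) : k) • x) : x * charIdem k χ S = x := by
  rw [charIdem, mul_smul_comm, Finset.mul_sum, Finset.sum_congr rfl (g := fun _ => x),
    Finset.sum_const, card_filter_mem, ← Nat.cast_smul_eq_nsmul k,
    inv_smul_smul₀ (card_subgroup_ne_zero S)]
  intro p hp
  rw [mul_smul_comm, hx p (by simpa using hp), character_smul_smul]

theorem charIdem_mul_charIdem (h : S ≤ T) :
    charIdem k χ S * charIdem k χ T = charIdem k χ T :=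
  charIdem_mul_eq χ fun _ hg => of_mul_charIdem χ (h hg)

theorem charIdem_mul_charIdem' (h : S ≤ T) :
    charIdem k χ T * charIdem k χ S = charIdem k χ T :=
  mul_charIdem_eq χ fun _ hg => charIdem_mul_of χ (h hg)

theorem charIdem_injective : Function.Injective (charIdem k χ) := by
  classical
  intro S T h
  ext g
  have h1 := congrArg (fun x => MonoidAlgebra.coeff x g ≠ 0) h
  have hχ : ((χ g : ℤ) : k) ≠ 0 := Int.cast_ne_zero.2 (Units.ne_zero _)
  simpa [charIdem_apply, hχ, card_subgroup_ne_zero] using h1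

theorem charIdem_ne_zero : charIdem k χ S ≠ 0 := by
  classical
  intro h
  have h1 := congrArg (fun x => MonoidAlgebra.coeff x 1) h
  simp [charIdem_apply] at h1

open Classical in
/-- If the complement of `S` is a single double coset, the elements `χ(g) e g e` for `g ∉ S` all
coincide, so averaging over `G` expresses them through `e` and the idempotent of `G`. -/
theorem exists_corner_eq
    (hdouble : ∀ g ∉ S, ∀ g' ∉ S, ∃ s ∈ S, ∃ t ∈ S, g' = s * g * t) (x : MonoidAlgebra k G) :
    ∃ a b : k, charIdem k χ S * x * charIdem k χ S = a • charIdem k χ ⊤ + b • charIdem k χ S := by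
  set e := charIdem k χ S with he
  set f := charIdem k χ (⊤ : Subgroup G) with hf
  have hee : e * e = e := charIdem_mul_charIdem χ le_rfl
  have hin : ∀ g ∈ S, ((χ g : ℤ) : k) • (e * MonoidAlgebra.of k G g * e) = e := by
    intro g hg
    rw [he, charIdem_mul_of χ hg, smul_mul_assoc, character_smul_smul, ← he, hee]
  have hout : ∀ g ∉ S, ∀ g' ∉ S, ((χ g' : ℤ) : k) • (e * MonoidAlgebra.of k G g' * e) =
      ((χ g : ℤ) : k) • (e * MonoidAlgebra.of k G g * e) := by
    intro g hg g' hg'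
    obtain ⟨s, hs, t, ht, rfl⟩ := hdouble g hg g' hg'
    have : e * MonoidAlgebra.of k G (s * g * t) * e =
        ((χ s : ℤ) : k) • ((χ t : ℤ) : k) • (e * MonoidAlgebra.of k G g * e) := by
      rw [map_mul, map_mul, ← mul_assoc, ← mul_assoc, he, charIdem_mul_of χ hs, smul_mul_assoc,
        smul_mul_assoc, smul_mul_assoc, mul_assoc _ _ (charIdem k χ S), of_mul_charIdem χ ht,
        mul_smul_comm]
    rw [this, map_mul, map_mul, Units.val_mul, Units.val_mul, Int.cast_mul, Int.cast_mul, mul_smul,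
      mul_smul, smul_comm ((χ g : ℤ) : k), smul_comm ((χ t : ℤ) : k) (((χ g : ℤ) : k)),
      smul_comm ((χ t : ℤ) : k) (((χ s : ℤ) : k)), smul_comm ((χ g : ℤ) : k) (((χ s : ℤ) : k)),
      character_smul_smul, character_smul_smul]
  have hgroup : ∀ g : G, ∃ a b : k, e * MonoidAlgebra.of k G g * e = a • f + b • e := by
    intro g
    by_cases hg : g ∈ S
    · refine ⟨0, ((χ g : ℤ) : k), ?_⟩
      rw [zero_smul, zero_add]
      nth_rw 3 [← hin g hg]
      rw [character_smul_smul]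
    · set w := ((χ g : ℤ) : k) • (e * MonoidAlgebra.of k G g * e) with hw
      let m := (Finset.univ.filter (fun p => p ∉ S)).card
      have hm : (m : k) ≠ 0 :=
        Nat.cast_ne_zero.2 (Finset.card_ne_zero_of_mem (a := g) (by simpa using hg))
      have hG : (Nat.card (⊤ : Subgroup G) : k) ≠ 0 := card_subgroup_ne_zero _
      have hsum : (Nat.card (⊤ : Subgroup G) : k) • f = (Nat.card S : k) • e + (m : k) • w := by
        have h1 : f = e * f * e := by
          rw [charIdem_mul_charIdem χ le_top, charIdem_mul_charIdem' χ le_top]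
        rw [h1, hf, charIdem, mul_smul_comm, smul_mul_assoc, smul_inv_smul₀ hG, Finset.mul_sum,
          Finset.sum_mul]
        simp only [Subgroup.mem_top, Finset.filter_true, mul_smul_comm, smul_mul_assoc]
        rw [← Finset.sum_filter_add_sum_filter_not Finset.univ (fun p => p ∈ S)]
        congr 1
        · rw [Finset.sum_congr rfl (g := fun _ => e) (fun p hp => hin p (by simpa using hp)),
            Finset.sum_const, card_filter_mem, ← Nat.cast_smul_eq_nsmul k]
        · rw [Finset.sum_congr rfl (g := fun _ => w) (fun p hp => hout g hg p (by simpa using hp)),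
            Finset.sum_const, ← Nat.cast_smul_eq_nsmul k]
      have hw' : e * MonoidAlgebra.of k G g * e = ((χ g : ℤ) : k) • (m : k)⁻¹ •
          ((Nat.card (⊤ : Subgroup G) : k) • f - (Nat.card S : k) • e) := by
        rw [hsum, add_sub_cancel_left, inv_smul_smul₀ hm, hw, character_smul_smul]
      refine ⟨((χ g : ℤ) : k) * ((m : k)⁻¹ * (Nat.card (⊤ : Subgroup G) : k)),
        -(((χ g : ℤ) : k) * ((m : k)⁻¹ * (Nat.card S : k))), ?_⟩
      rw [hw', smul_sub, smul_sub, neg_smul, ← sub_eq_add_neg]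
      simp only [smul_smul]
  induction x using MonoidAlgebra.induction_on with
  | of g => exact hgroup g
  | add x y hx hy =>
    obtain ⟨a, b, h1⟩ := hx
    obtain ⟨c, d, h2⟩ := hy
    exact ⟨a + c, b + d, by rw [mul_add, add_mul, h1, h2]; module⟩
  | smul r x hx =>
    obtain ⟨a, b, h1⟩ := hx
    exact ⟨r * a, r * b, by rw [mul_smul_comm, smul_mul_assoc, h1]; module⟩

theorem splitsCorner_charIdem (hS : S ≠ ⊤)
    (hdouble : ∀ g ∉ S, ∀ g' ∉ S, ∃ s ∈ S, ∃ t ∈ S, g' = s * g * t) :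
    SplitsCorner k (charIdem k χ S) (charIdem k χ ⊤) (charIdem k χ S - charIdem k χ ⊤) where
  idem_left := charIdem_mul_charIdem χ le_rfl
  idem_right := by
    rw [sub_mul, mul_sub, mul_sub, charIdem_mul_charIdem χ le_rfl, charIdem_mul_charIdem χ le_top,
      charIdem_mul_charIdem' χ le_top, charIdem_mul_charIdem χ le_rfl, sub_self, sub_zero]
  mul_eq_zero := by
    rw [mul_sub, charIdem_mul_charIdem' χ le_top, charIdem_mul_charIdem χ le_rfl, sub_self]
  mul_eq_zero' := by
    rw [sub_mul, charIdem_mul_charIdem χ le_top, charIdem_mul_charIdem χ le_rfl, sub_self]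
  left_ne_zero := charIdem_ne_zero χ
  right_ne_zero := sub_ne_zero.2 fun h => hS (charIdem_injective χ h)
  eq_add := by rw [add_sub_cancel]
  corner x := by
    obtain ⟨a, b, h⟩ := exists_corner_eq (k := k) χ hdouble x
    exact ⟨a + b, b, by rw [h]; module⟩

end

end SymClass

namespace SymClass

/-! ### Young symmetrizers of rows, columns and hooks -/

theorem grp_mul (𝕜 : Type*) [RCLike 𝕜] {n : ℕ} (p q : Equiv.Perm (Fin n)) :
    grp 𝕜 (p * q) = grp 𝕜 p * grp 𝕜 q :=
  map_mul _ _ _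

theorem sgn_one (𝕜 : Type*) [RCLike 𝕜] {n : ℕ} : sgn 𝕜 (1 : Equiv.Perm (Fin n)) = 1 := by
  simp [sgn]

theorem sgn_swap (𝕜 : Type*) [RCLike 𝕜] {n : ℕ} {a b : Fin n} (h : a ≠ b) :
    sgn 𝕜 (Equiv.swap a b) = -1 := by
  simp [sgn, Equiv.Perm.sign_swap h]

theorem mem_frame_iff {n : ℕ} {μ : n.Partition} {w : List ℕ} (hw : w.Pairwise (· ≥ ·))
    (hμ : μ.parts = (w : Multiset ℕ)) (c : ℕ × ℕ) :
    c ∈ (frame μ).cells ↔ ∃ h : c.1 < w.length, c.2 < w[c.1] := by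
  have hsort : μ.parts.sort (· ≥ ·) = w := by
    rw [hμ, Multiset.coe_sort]
    exact List.mergeSort_of_pairwise (by simpa using hw)
  obtain ⟨i, j⟩ := c
  rw [YoungDiagram.mem_cells]
  subst hsort
  exact YoungDiagram.mem_ofRowLens

theorem mem_frame_rowPartition {n : ℕ} {c : ℕ × ℕ} (hc : c ∈ (frame (rowPartition n)).cells) :
    c.1 = 0 := by
  rcases Nat.eq_zero_or_pos n with rfl | hn
  · rw [mem_frame_iff (w := []) (by simp) (by simp [rowPartition])] at hc
    obtain ⟨h, -⟩ := hc
    simp at h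
  · rw [mem_frame_iff (w := [n]) (by simp)
      (by simp [rowPartition, Multiset.filter_singleton, hn.ne'])] at hc
    obtain ⟨h, -⟩ := hc
    simpa using h

theorem mem_frame_colPartition {n : ℕ} {c : ℕ × ℕ} (hc : c ∈ (frame (colPartition n)).cells) :
    c.2 = 0 := by
  rw [mem_frame_iff (w := List.replicate n 1) (by simp [List.pairwise_replicate]) (by
    rw [colPartition, Nat.Partition.ofSums_parts, Multiset.coe_replicate, Multiset.filter_eq_self]
    intro a ha
    rw [Multiset.eq_of_mem_replicate ha]
    exact one_ne_zero)] at hc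
  obtain ⟨h, h2⟩ := hc
  simpa using h2

theorem mem_frame_rowHook {r : ℕ} (hr : 1 ≤ r) (c : ℕ × ℕ) :
    c ∈ (frame (rowHook r)).cells ↔ (c.1 = 0 ∧ c.2 < r) ∨ c = (1, 0) := by
  rw [mem_frame_iff (w := [r, 1]) (by simpa using hr) (by
    rw [rowHook, Nat.Partition.ofSums_parts, Multiset.filter_eq_self.2]
    · rfl
    · simp
      omega)]
  obtain ⟨i, j⟩ := c
  rcases i with _ | _ | i <;> simp

theorem mem_frame_colHook {r : ℕ} (hr : 1 ≤ r) (c : ℕ × ℕ) :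
    c ∈ (frame (colHook r hr)).cells ↔ (c.2 = 0 ∧ c.1 < r) ∨ c = (0, 1) := by
  rw [mem_frame_iff (w := 2 :: List.replicate (r - 1) 1) (by
    rw [List.pairwise_cons]
    refine ⟨fun a ha => ?_, by simp [List.pairwise_replicate]⟩
    rw [List.eq_of_mem_replicate ha]
    omega) (by
    rw [colHook, Nat.Partition.ofSums_parts, Multiset.filter_eq_self.2]
    · rfl
    · intro a ha
      rcases Multiset.mem_cons.1 ha with rfl | ha
      · omega
      · rw [Multiset.eq_of_mem_replicate ha]
        omega)]
  obtain ⟨i, j⟩ := c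
  rcases i with _ | i
  · simp
    omega
  · simp
    omega

section

variable {𝕜 : Type*} [RCLike 𝕜] {n : ℕ} {μ : n.Partition} (t : Tableau μ)

theorem isHorizontal_one : IsHorizontal t 1 := fun _ => rfl

theorem isVertical_one : IsVertical t 1 := fun _ => rfl

variable {t} in
theorem eq_one_of_isHorizontal_of_isVertical {p : Equiv.Perm (Fin n)} (h : IsHorizontal t p)
    (v : IsVertical t p) : p = 1 := by
  ext1 i
  exact t.symm.injective (Subtype.ext (Prod.ext (h i) (v i)))

variable {t} in
theorem IsVertical.inv {q : Equiv.Perm (Fin n)} (v : IsVertical t q) : IsVertical t q⁻¹ := by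
  intro i
  have := v (q⁻¹ i)
  have hi : q (q⁻¹ i) = i := q.apply_symm_apply i
  rw [hi] at this
  exact this.symm

/-- The coefficient of the identity in a Young symmetrizer is `1`: the only permutation that is both
horizontal and vertical is the identity. -/
theorem youngSymmetrizer_ne_zero : youngSymmetrizer 𝕜 t ≠ 0 := by
  classical
  intro h
  have h1 := congrArg (fun x => MonoidAlgebra.coeff x 1) h
  simp only [youngSymmetrizer, MonoidAlgebra.of_apply, MonoidAlgebra.coeff_smul,
    MonoidAlgebra.coeff_sum, MonoidAlgebra.coeff_single, Finsupp.smul_apply,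
    Finsupp.finsetSum_apply, Finsupp.single_apply, MonoidAlgebra.coeff_zero,
    Finsupp.zero_apply] at h1
  rw [Finset.sum_eq_single_of_mem 1 (by simpa using isHorizontal_one t),
    Finset.sum_eq_single_of_mem 1 (by simpa using isVertical_one t)] at h1
  · simp at h1
  · intro q _ hq
    simp [hq]
  · intro p hp hp1
    refine Finset.sum_eq_zero fun q hq => ?_
    simp only [Finset.mem_filter, Finset.mem_univ, true_and] at hp hq
    have : p * q ≠ 1 := by
      intro hpq
      rw [mul_eq_one_iff_eq_inv] at hpq
      exact hp1 (eq_one_of_isHorizontal_of_isVertical hp (hpq ▸ hq.inv))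
    simp [this]

end

section

variable (𝕜 : Type*) [RCLike 𝕜] {n : ℕ}

theorem youngSymmetrizer_rowPartition (t : Tableau (rowPartition n)) :
    youngSymmetrizer 𝕜 t = ∑ p : Equiv.Perm (Fin n), grp 𝕜 p := by
  classical
  have hH : ∀ p, IsHorizontal t p := fun p i => by
    rw [mem_frame_rowPartition (t.symm (p i)).2, mem_frame_rowPartition (t.symm i).2]
  have hV : ∀ q, IsVertical t q ↔ q = 1 := fun q =>
    ⟨eq_one_of_isHorizontal_of_isVertical (hH q), fun h => h ▸ isVertical_one t⟩
  simp only [youngSymmetrizer, hH, hV, Finset.filter_true, Finset.filter_eq', Finset.mem_univ,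
    if_true, Finset.sum_singleton, mul_one, sgn_one, one_smul]

theorem youngSymmetrizer_colPartition (t : Tableau (colPartition n)) :
    youngSymmetrizer 𝕜 t = ∑ p : Equiv.Perm (Fin n), sgn 𝕜 p • grp 𝕜 p := by
  classical
  have hV : ∀ q, IsVertical t q := fun p i => by
    rw [mem_frame_colPartition (t.symm (p i)).2, mem_frame_colPartition (t.symm i).2]
  have hH : ∀ p, IsHorizontal t p ↔ p = 1 := fun p =>
    ⟨fun h => eq_one_of_isHorizontal_of_isVertical h (hV p), fun h => h ▸ isHorizontal_one t⟩
  simp only [youngSymmetrizer, hH, hV, Finset.filter_true, Finset.filter_eq', Finset.mem_univ,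
    if_true, Finset.sum_singleton, one_mul]

end

/-- If the level sets of `R` are `{b}` and its complement, the permutations preserving `R` are those
fixing `b`. -/
theorem preserves_iff_fixes {α : Type*} [DecidableEq α] {R : α → ℕ} {b : α} {k l : ℕ} (hkl : k ≠ l)
    (hR : ∀ i, R i = if i = b then k else l) (p : Equiv.Perm α) :
    (∀ i, R (p i) = R i) ↔ p b = b := by
  constructor
  · intro h
    have := h b
    rw [hR, hR b, if_pos rfl] at this
    by_contra hb
    rw [if_neg hb] at this
    exact hkl this.symm
  · intro h i
    have : p i = b ↔ i = b := by
      nth_rw 1 [← h]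
      exact p.injective.eq_iff
    simp only [hR, this]

/-- If the only coincidence among the values of `C` is `C a = C b`, the permutations preserving `C`
are the identity and the transposition of `a` and `b`. -/
theorem preserves_iff_swap {α : Type*} [DecidableEq α] {C : α → ℕ} {a b : α}
    (hC : ∀ i j, C i = C j → i = j ∨ (i = a ∧ j = b) ∨ (i = b ∧ j = a)) (hab : C a = C b)
    (q : Equiv.Perm α) : (∀ i, C (q i) = C i) ↔ q = 1 ∨ q = Equiv.swap a b := by
  constructor
  · intro h
    have hq : ∀ i, q i = i ∨ (q i = a ∧ i = b) ∨ (q i = b ∧ i = a) := fun i => hC _ _ (h i)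
    by_cases ha : q a = a
    · left
      ext1 i
      rcases hq i with h | ⟨h, rfl⟩ | ⟨h, rfl⟩
      · exact h
      · rw [h]
        exact q.injective (ha.trans h.symm)
      · rw [ha]
        rfl
    · right
      have hqa : q a = b := by
        rcases hq a with h | ⟨h, -⟩ | ⟨h, -⟩
        · exact absurd h ha
        · exact absurd h ha
        · exact h
      ext1 i
      rcases hq i with h | ⟨h, rfl⟩ | ⟨h, rfl⟩
      · by_cases hib : i = b
        · subst hib
          exact absurd (q.injective (hqa.trans h.symm) ▸ h) ha
        · by_cases hia : i = a
          · exact absurd (hia ▸ h) ha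
          · rw [h, Equiv.swap_apply_of_ne_of_ne hia hib]
      · rw [h, Equiv.swap_apply_right]
      · rw [h, Equiv.swap_apply_left]
  · rintro (rfl | rfl) i
    · rfl
    · by_cases hia : i = a
      · rw [hia, Equiv.swap_apply_left, hab]
      · by_cases hib : i = b
        · rw [hib, Equiv.swap_apply_right, hab]
        · rw [Equiv.swap_apply_of_ne_of_ne hia hib]

section

variable (𝕜 : Type*) [RCLike 𝕜] {r : ℕ}

/-- `a` and `b` are the entries of the corner box and of the box below it. -/
theorem exists_youngSymmetrizer_rowHook (hr : 1 ≤ r) (t : Tableau (rowHook r)) :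
    ∃ a b : Fin (r + 1), a ≠ b ∧ youngSymmetrizer 𝕜 t =
      (∑ p : Equiv.Perm (Fin (r + 1)) with p b = b, grp 𝕜 p) * (1 - grp 𝕜 (Equiv.swap a b)) := by
  classical
  have ha : ((0, 0) : ℕ × ℕ) ∈ (frame (rowHook r)).cells :=
    (mem_frame_rowHook hr _).2 (Or.inl ⟨rfl, hr⟩)
  have hb : ((1, 0) : ℕ × ℕ) ∈ (frame (rowHook r)).cells := (mem_frame_rowHook hr _).2 (Or.inr rfl)
  set a := t ⟨_, ha⟩
  set b := t ⟨_, hb⟩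
  have hta : t.symm a = ⟨_, ha⟩ := t.symm_apply_apply _
  have htb : t.symm b = ⟨_, hb⟩ := t.symm_apply_apply _
  have hne : a ≠ b := fun h => by
    have := t.injective h
    simp at this
  have eq_a : ∀ i, (t.symm i).1 = (0, 0) → i = a := fun i hi =>
    t.symm.injective (Subtype.ext (hi.trans (congrArg Subtype.val hta).symm))
  have eq_b : ∀ i, (t.symm i).1 = (1, 0) → i = b := fun i hi =>
    t.symm.injective (Subtype.ext (hi.trans (congrArg Subtype.val htb).symm))
  have hcell : ∀ i, (t.symm i).1.1 = 0 ∨ i = b := fun i =>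
    ((mem_frame_rowHook hr _).1 (t.symm i).2).imp (fun h => h.1) (eq_b i)
  have hH : ∀ p, IsHorizontal t p ↔ p b = b := by
    refine preserves_iff_fixes (R := fun i => (t.symm i).1.1) one_ne_zero fun i => ?_
    split_ifs with h
    · rw [h, htb]
    · exact (hcell i).resolve_right h
  have hV : ∀ q, IsVertical t q ↔ q = 1 ∨ q = Equiv.swap a b := by
    refine preserves_iff_swap (C := fun i => (t.symm i).1.2) ?_ (by simp only [hta, htb])
    intro i j hij
    rcases hcell i with hi | rfl <;> rcases hcell j with hj | rfl
    · exact Or.inl (t.symm.injective (Subtype.ext (Prod.ext (hi.trans hj.symm) hij)))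
    · rw [htb] at hij
      exact Or.inr (Or.inl ⟨eq_a i (Prod.ext hi hij), rfl⟩)
    · rw [htb] at hij
      exact Or.inr (Or.inr ⟨rfl, eq_a j (Prod.ext hj hij.symm)⟩)
    · exact Or.inl rfl
  have hs : (1 : Equiv.Perm (Fin (r + 1))) ≠ Equiv.swap a b := fun h =>
    hne (Equiv.swap_eq_one_iff.1 h.symm)
  refine ⟨a, b, hne, ?_⟩
  simp only [youngSymmetrizer, hH, hV, Finset.filter_or, Finset.filter_eq', Finset.mem_univ, if_true]
  rw [Finset.sum_mul]
  refine Finset.sum_congr rfl fun p _ => ?_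
  rw [Finset.sum_union (by simpa using hs), Finset.sum_singleton, Finset.sum_singleton, mul_sub,
    sgn_one, sgn_swap 𝕜 hne, one_smul, mul_one, mul_one, neg_one_smul, grp_mul, sub_eq_add_neg]

/-- `a` and `b` are the entries of the corner box and of the box to the right of it. -/
theorem exists_youngSymmetrizer_colHook (hr : 1 ≤ r) (t : Tableau (colHook r hr)) :
    ∃ a b : Fin (r + 1), a ≠ b ∧ youngSymmetrizer 𝕜 t =
      (1 + grp 𝕜 (Equiv.swap a b)) *
        ∑ q : Equiv.Perm (Fin (r + 1)) with q b = b, sgn 𝕜 q • grp 𝕜 q := by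
  classical
  have ha : ((0, 0) : ℕ × ℕ) ∈ (frame (colHook r hr)).cells :=
    (mem_frame_colHook hr _).2 (Or.inl ⟨rfl, hr⟩)
  have hb : ((0, 1) : ℕ × ℕ) ∈ (frame (colHook r hr)).cells :=
    (mem_frame_colHook hr _).2 (Or.inr rfl)
  set a := t ⟨_, ha⟩
  set b := t ⟨_, hb⟩
  have hta : t.symm a = ⟨_, ha⟩ := t.symm_apply_apply _
  have htb : t.symm b = ⟨_, hb⟩ := t.symm_apply_apply _
  have hne : a ≠ b := fun h => by
    have := t.injective h
    simp at this
  have eq_a : ∀ i, (t.symm i).1 = (0, 0) → i = a := fun i hi =>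
    t.symm.injective (Subtype.ext (hi.trans (congrArg Subtype.val hta).symm))
  have eq_b : ∀ i, (t.symm i).1 = (0, 1) → i = b := fun i hi =>
    t.symm.injective (Subtype.ext (hi.trans (congrArg Subtype.val htb).symm))
  have hcell : ∀ i, (t.symm i).1.2 = 0 ∨ i = b := fun i =>
    ((mem_frame_colHook hr _).1 (t.symm i).2).imp (fun h => h.1) (eq_b i)
  have hV : ∀ q, IsVertical t q ↔ q b = b := by
    refine preserves_iff_fixes (R := fun i => (t.symm i).1.2) one_ne_zero fun i => ?_
    split_ifs with h
    · rw [h, htb]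
    · exact (hcell i).resolve_right h
  have hH : ∀ p, IsHorizontal t p ↔ p = 1 ∨ p = Equiv.swap a b := by
    refine preserves_iff_swap (C := fun i => (t.symm i).1.1) ?_ (by simp only [hta, htb])
    intro i j hij
    rcases hcell i with hi | rfl <;> rcases hcell j with hj | rfl
    · exact Or.inl (t.symm.injective (Subtype.ext (Prod.ext hij (hi.trans hj.symm))))
    · rw [htb] at hij
      exact Or.inr (Or.inl ⟨eq_a i (Prod.ext hij hi), rfl⟩)
    · rw [htb] at hij
      exact Or.inr (Or.inr ⟨rfl, eq_a j (Prod.ext hij.symm hj)⟩)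
    · exact Or.inl rfl
  have hs : (1 : Equiv.Perm (Fin (r + 1))) ≠ Equiv.swap a b := fun h =>
    hne (Equiv.swap_eq_one_iff.1 h.symm)
  refine ⟨a, b, hne, ?_⟩
  simp only [youngSymmetrizer, hH, hV, Finset.filter_or, Finset.filter_eq', Finset.mem_univ, if_true]
  rw [Finset.sum_union (by simpa using hs), Finset.sum_singleton, Finset.sum_singleton, add_mul,
    one_mul, Finset.mul_sum]
  simp

end

end SymClass

namespace SymClass

open scoped TensorProduct

/-! ### Representations on left ideals -/

section

variable {𝕜 : Type*} [RCLike 𝕜] {n : ℕ}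

theorem leftRegular_apply_eq_mul (g : Equiv.Perm (Fin n)) (x : GroupRing 𝕜 n) :
    Representation.leftRegular 𝕜 (Equiv.Perm (Fin n)) g x = grp 𝕜 g * x := by
  rw [← Representation.asAlgebraHom_ofMulAction_smul_eq_mul, Representation.asAlgebraHom_of]

theorem coe_idealRep_apply (I : Ideal (GroupRing 𝕜 n)) (g : Equiv.Perm (Fin n))
    (x : I.restrictScalars 𝕜) : (idealRep I g x : GroupRing 𝕜 n) = grp 𝕜 g * x.1 :=
  leftRegular_apply_eq_mul g x.1

/-- Isomorphic left ideals carry equivalent representations. -/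
noncomputable def idealRepEquiv {I J : Ideal (GroupRing 𝕜 n)} (φ : I ≃ₗ[GroupRing 𝕜 n] J) :
    (idealRep I).Equiv (idealRep J) :=
  .mk (φ.restrictScalars 𝕜) fun g => by
    refine LinearMap.ext fun x => ?_
    have h : idealRep I g x = (grp 𝕜 g • (show I from x) : I) :=
      Subtype.ext (coe_idealRep_apply I g x)
    change φ (idealRep I g x) = idealRep J g (φ x)
    rw [h]
    exact (φ.map_smul (grp 𝕜 g) x).trans (Subtype.ext (coe_idealRep_apply J g (φ x)).symm)

/-- For orthogonal idempotents, `A (f + h)` is the direct sum of `A f` and `A h`. -/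
theorem nonempty_equiv_prod {e f h : GroupRing 𝕜 n} (hff : f * f = f) (hhh : h * h = h)
    (hfh : f * h = 0) (hhf : h * f = 0) (he : e = f + h) :
    Nonempty ((idealRep (leftIdeal e)).Equiv
      ((idealRep (leftIdeal f)).prod (idealRep (leftIdeal h)))) := by
  have hmem : ∀ {a x : GroupRing 𝕜 n}, x * a ∈ (leftIdeal a).restrictScalars 𝕜 := fun {a x} =>
    Ideal.mul_mem_left _ _ (Ideal.mem_span_singleton_self a)
  have hfe : f * e = f := by rw [he, mul_add, hff, hfh, add_zero]
  have hhe : h * e = h := by rw [he, mul_add, hhh, hhf, zero_add]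
  have hee : e * e = e := by nth_rw 1 [he]; rw [add_mul, hfe, hhe, he]
  have hle : ∀ {a x : GroupRing 𝕜 n}, a * e = a → x ∈ leftIdeal a → x ∈ leftIdeal e := by
    intro a x ha hx
    obtain ⟨y, rfl⟩ := Ideal.mem_span_singleton'.1 hx
    rw [← ha, ← mul_assoc]
    exact hmem
  let φ : (leftIdeal e).restrictScalars 𝕜 ≃ₗ[𝕜]
      (leftIdeal f).restrictScalars 𝕜 × (leftIdeal h).restrictScalars 𝕜 :=
    { toFun := fun x => (⟨x * f, hmem⟩, ⟨x * h, hmem⟩)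
      map_add' := fun x y => by ext1 <;> ext1 <;> exact add_mul _ _ _
      map_smul' := fun c x => by ext1 <;> ext1 <;> exact smul_mul_assoc c _ _
      invFun := fun y => ⟨y.1 + y.2, Submodule.add_mem _ (hle hfe y.1.2) (hle hhe y.2.2)⟩
      left_inv := fun x => by
        ext1
        change (x : GroupRing 𝕜 n) * f + x * h = x
        rw [← mul_add, ← he]
        exact mul_right_eq_self_of_mem_span hee x.2
      right_inv := fun y => by
        have h1 : (y.1 : GroupRing 𝕜 n) * f = y.1 := mul_right_eq_self_of_mem_span hff y.1.2
        have h2 : (y.2 : GroupRing 𝕜 n) * h = y.2 := mul_right_eq_self_of_mem_span hhh y.2.2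
        ext1 <;> ext1
        · change ((y.1 : GroupRing 𝕜 n) + y.2) * f = y.1
          rw [add_mul, h1, ← h2, mul_assoc, hhf, mul_zero, add_zero]
        · change ((y.1 : GroupRing 𝕜 n) + y.2) * h = y.2
          rw [add_mul, h2, ← h1, mul_assoc, hfh, mul_zero, zero_add] }
  refine ⟨.mk φ fun g => ?_⟩
  refine LinearMap.ext fun x => Prod.ext (Subtype.ext ?_) (Subtype.ext ?_)
  · change (idealRep (leftIdeal e) g x).1 * f = (idealRep (leftIdeal f) g (φ x).1).1
    rw [coe_idealRep_apply, coe_idealRep_apply, mul_assoc]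
    rfl
  · change (idealRep (leftIdeal e) g x).1 * h = (idealRep (leftIdeal h) g (φ x).2).1
    rw [coe_idealRep_apply, coe_idealRep_apply, mul_assoc]
    rfl

/-- Equivalent summands give equivalent direct sums. -/
noncomputable def prodEquiv {G V V' W W' : Type*} [Group G] [AddCommGroup V] [Module 𝕜 V] [AddCommGroup V']
    [Module 𝕜 V'] [AddCommGroup W] [Module 𝕜 W] [AddCommGroup W'] [Module 𝕜 W']
    {ρ : Representation 𝕜 G V} {ρ' : Representation 𝕜 G V'} {σ : Representation 𝕜 G W}
    {σ' : Representation 𝕜 G W'} (φ : ρ.Equiv ρ') (ψ : σ.Equiv σ') :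
    (ρ.prod σ).Equiv (ρ'.prod σ') :=
  .mk (φ.toLinearEquiv.prodCongr ψ.toLinearEquiv) fun g => by
    refine LinearMap.ext fun x => Prod.ext ?_ ?_
    · exact LinearMap.congr_fun (φ.isIntertwining' g) x.1
    · exact LinearMap.congr_fun (ψ.isIntertwining' g) x.2

/-- If the group acts on `y` through scalars, then the left ideal of `y` is one-dimensional. -/
theorem exists_linearEquiv_of_grp_mul {c : Equiv.Perm (Fin n) → 𝕜} {y : GroupRing 𝕜 n} (hy : y ≠ 0)
    (hc : ∀ g, grp 𝕜 g * y = c g • y) :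
    Nonempty ((leftIdeal y).restrictScalars 𝕜 ≃ₗ[𝕜] 𝕜) ∧
      ∀ g x, idealRep (leftIdeal y) g x = c g • x := by
  have hspan : ∀ x : GroupRing 𝕜 n, ∃ a : 𝕜, x * y = a • y := by
    intro x
    induction x using MonoidAlgebra.induction_on with
    | of g => exact ⟨c g, hc g⟩
    | add u v hu hv =>
      obtain ⟨a, ha⟩ := hu
      obtain ⟨b, hb⟩ := hv
      exact ⟨a + b, by rw [add_mul, ha, hb, add_smul]⟩
    | smul s u hu =>
      obtain ⟨a, ha⟩ := hu
      exact ⟨s * a, by rw [smul_mul_assoc, ha, mul_smul]⟩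
  have heq : Submodule.span 𝕜 {y} = (leftIdeal y).restrictScalars 𝕜 := by
    ext x
    rw [Submodule.mem_span_singleton, Submodule.restrictScalars_mem, Ideal.mem_span_singleton']
    constructor
    · rintro ⟨a, rfl⟩
      exact ⟨a • 1, by rw [smul_mul_assoc, one_mul]⟩
    · rintro ⟨x, rfl⟩
      obtain ⟨a, ha⟩ := hspan x
      exact ⟨a, ha.symm⟩
  refine ⟨⟨(LinearEquiv.ofEq _ _ heq.symm).trans (LinearEquiv.toSpanNonzeroSingleton 𝕜 _ y hy).symm⟩,
    fun g x => Subtype.ext ?_⟩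
  rw [coe_idealRep_apply]
  obtain ⟨a, ha⟩ := Submodule.mem_span_singleton.1 (heq.symm ▸ x.2 : x.1 ∈ Submodule.span 𝕜 {y})
  rw [Submodule.coe_smul, ← ha, mul_smul_comm, hc, smul_comm]

end

/-! ### Representations induced from a sign character -/

section

variable {𝕜 : Type*} [RCLike 𝕜] {n : ℕ} {L : Type*} [Group L] (φ : L →* Equiv.Perm (Fin n))
  (χ : Equiv.Perm (Fin n) →* ℤˣ) {V : Type*} [AddCommGroup V] [Module 𝕜 V]
  {ρ : Representation 𝕜 L V}

theorem indMk_mul (hρ : ∀ l v, ρ l v = ((χ (φ l) : ℤ) : 𝕜) • v) (l : L) (g : Equiv.Perm (Fin n))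
    (v : V) : Representation.IndV.mk φ ρ ((φ l)⁻¹ * g) v =
      ((χ (φ l) : ℤ) : 𝕜) • Representation.IndV.mk φ ρ g v := by
  have h := Representation.Coinvariants.mk_self_apply
    (Representation.tprod ((Representation.leftRegular 𝕜 _).comp φ) ρ) l
    (MonoidAlgebra.single ((φ l)⁻¹ * g) (1 : 𝕜) ⊗ₜ[𝕜] v)
  rw [Representation.tprod_apply, TensorProduct.map_tmul, hρ] at h
  change Representation.Coinvariants.mk _ _ = _
  rw [TensorProduct.mk_apply, ← h, TensorProduct.tmul_smul, map_smul]
  simp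

/-- The representation induced from the one-dimensional representation `χ ∘ φ` of `L` is carried by
the left ideal of the idempotent of `χ` on the image of `φ`; the class of `g ⊗ v` corresponds to
the multiple of `g⁻¹ e` by the coordinate of `v`. -/
theorem nonempty_equiv_ind (ℓ : V ≃ₗ[𝕜] 𝕜) (hρ : ∀ l v, ρ l v = ((χ (φ l) : ℤ) : 𝕜) • v) :
    Nonempty ((idealRep (leftIdeal (charIdem 𝕜 χ φ.range))).Equiv (Representation.ind φ ρ)) := by
  classical
  set e := charIdem 𝕜 χ φ.range with he
  have hee : e * e = e := charIdem_mul_charIdem χ le_rfl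
  let inv : GroupRing 𝕜 n →ₗ[𝕜] GroupRing 𝕜 n := MonoidAlgebra.mapDomainLinearMap 𝕜 𝕜 (·⁻¹)
  have hinv : ∀ g a, inv (MonoidAlgebra.single g a) = MonoidAlgebra.single g⁻¹ a := fun g a => by
    simp [inv]
  let F₀ : GroupRing 𝕜 n ⊗[𝕜] V →ₗ[𝕜] GroupRing 𝕜 n :=
    TensorProduct.lift ((LinearMap.lsmul 𝕜 (GroupRing 𝕜 n)).flip.comp
      ((LinearMap.mulRight 𝕜 e).comp inv) |>.compl₂ ℓ.toLinearMap)
  have hF₀ : ∀ g v, F₀ (MonoidAlgebra.single g 1 ⊗ₜ v) = ℓ v • (grp 𝕜 g⁻¹ * e) := fun g v => by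
    simp [F₀, hinv]
  let F : Representation.IndV φ ρ →ₗ[𝕜] GroupRing 𝕜 n :=
    Representation.Coinvariants.lift _ F₀ fun l => by
      refine TensorProduct.ext (MonoidAlgebra.lhom_ext' fun g => LinearMap.ext_ring ?_)
      ext1 v
      change F₀ (Representation.leftRegular 𝕜 _ (φ l) (MonoidAlgebra.single g 1) ⊗ₜ ρ l v) =
        F₀ (MonoidAlgebra.single g 1 ⊗ₜ v)
      rw [leftRegular_apply_eq_mul, hρ, grp, MonoidAlgebra.of_apply,
        MonoidAlgebra.single_mul_single, one_mul, hF₀, hF₀, map_smul, mul_inv_rev, grp_mul,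
        mul_assoc, of_mul_charIdem χ (φ.range.inv_mem ⟨l, rfl⟩), character_inv, mul_smul_comm,
        smul_assoc, smul_comm, character_smul_smul]
  have hF : ∀ g v, F (Representation.IndV.mk φ ρ g v) = ℓ v • (grp 𝕜 g⁻¹ * e) := hF₀
  let E : GroupRing 𝕜 n →ₗ[𝕜] Representation.IndV φ ρ :=
    Representation.Coinvariants.mk _ ∘ₗ (TensorProduct.mk 𝕜 _ _).flip (ℓ.symm 1) ∘ₗ inv
  have hE : ∀ g, E (grp 𝕜 g) = Representation.IndV.mk φ ρ g⁻¹ (ℓ.symm 1) := fun g => by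
    simp [E, hinv]
  have hFE : ∀ x, F (E x) = x * e := by
    intro x
    induction x using MonoidAlgebra.induction_on with
    | of g => rw [hE, hF, LinearEquiv.apply_symm_apply, one_smul, inv_inv]
    | add u v hu hv => rw [map_add, map_add, hu, hv, add_mul]
    | smul s u hu => rw [map_smul, map_smul, hu, smul_mul_assoc]
  have hEF : E ∘ₗ F = LinearMap.id := by
    refine Representation.IndV.hom_ext φ ρ fun g => ?_
    ext1 v
    change E (F (Representation.IndV.mk φ ρ g v)) = Representation.IndV.mk φ ρ g v
    rw [hF, map_smul, he, charIdem, mul_smul_comm, Finset.mul_sum, map_smul, map_sum,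
      Finset.sum_congr rfl (g := fun _ => Representation.IndV.mk φ ρ g (ℓ.symm 1)),
      Finset.sum_const, card_filter_mem, ← Nat.cast_smul_eq_nsmul 𝕜,
      inv_smul_smul₀ (card_subgroup_ne_zero _), ← map_smul, ← map_smul, smul_eq_mul, mul_one,
      LinearEquiv.symm_apply_apply]
    intro p hp
    obtain ⟨l, rfl⟩ : p ∈ φ.range := by simpa using hp
    rw [mul_smul_comm, map_smul, ← map_mul, hE, mul_inv_rev, inv_inv, indMk_mul φ χ hρ,
      character_smul_smul]
  have hmem : ∀ x, F x ∈ (leftIdeal e).restrictScalars 𝕜 := by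
    intro x
    have h1 : F x = F x * e := by
      rw [← hFE]
      exact congrArg F (LinearMap.congr_fun hEF x).symm
    rw [h1]
    exact Ideal.mul_mem_left _ _ (Ideal.mem_span_singleton_self e)
  refine ⟨.mk (LinearEquiv.ofLinearMap (E ∘ₗ Submodule.subtype _) (F.codRestrict _ hmem) hEF ?_)
    fun g => ?_⟩
  · ext1 x
    refine Subtype.ext ((hFE x).trans ?_)
    exact mul_right_eq_self_of_mem_span hee x.2
  · ext1 x
    change E (idealRep (leftIdeal e) g x).1 = Representation.ind φ ρ g (E x.1)
    rw [coe_idealRep_apply]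
    generalize x.1 = y
    induction y using MonoidAlgebra.induction_on with
    | of p =>
      have : grp 𝕜 g * MonoidAlgebra.of 𝕜 _ p = grp 𝕜 (g * p) := (map_mul _ _ _).symm
      rw [this, hE, hE, Representation.ind_mk, mul_inv_rev]
    | add u v hu hv => rw [mul_add, map_add, map_add, map_add, hu, hv]
    | smul s u hu => rw [mul_smul_comm, map_smul, map_smul, map_smul, hu]

end

end SymClass

namespace SymClass

open scoped TensorProduct

/-! ### The Young subgroup fixing the last point -/

/-- The subgroup of `S_{r+1}` fixing the last point. -/
abbrev stabLast (r : ℕ) : Subgroup (Equiv.Perm (Fin (r + 1))) :=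
  MulAction.stabilizer _ (Fin.last r)

theorem mem_stabLast {r : ℕ} {p : Equiv.Perm (Fin (r + 1))} :
    p ∈ stabLast r ↔ p (Fin.last r) = Fin.last r :=
  Iff.rfl

theorem card_stabLast (r : ℕ) : Nat.card (stabLast r) = r.factorial := by
  have h := (stabLast r).card_mul_index
  rw [MulAction.index_stabilizer_of_transitive, Nat.card_perm, Nat.card_fin, Nat.factorial_succ,
    mul_comm] at h
  exact Nat.eq_of_mul_eq_mul_left (Nat.succ_pos r) h

theorem stabLast_ne_top {r : ℕ} (hr : 1 ≤ r) : stabLast r ≠ ⊤ := by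
  intro h
  have h0 : Equiv.swap (Fin.last r) 0 ∈ stabLast r := h ▸ Subgroup.mem_top _
  rw [mem_stabLast, Equiv.swap_apply_left] at h0
  have := congrArg Fin.val h0
  simp at this
  omega

/-- The complement of the stabilizer is a single double coset, by double transitivity. -/
theorem exists_eq_mul_mul_of_notMem_stabLast {r : ℕ} (g : Equiv.Perm (Fin (r + 1)))
    (hg : g ∉ stabLast r) (g' : Equiv.Perm (Fin (r + 1))) (hg' : g' ∉ stabLast r) :
    ∃ s ∈ stabLast r, ∃ t ∈ stabLast r, g' = s * g * t := by
  rw [mem_stabLast] at hg hg'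
  set s := Equiv.swap (g (Fin.last r)) (g' (Fin.last r))
  refine ⟨s, ?_, (s * g)⁻¹ * g', ?_, by group⟩
  · exact Equiv.swap_apply_of_ne_of_ne (Ne.symm hg) (Ne.symm hg')
  · rw [mem_stabLast, Equiv.Perm.mul_apply, Equiv.Perm.inv_eq_iff_eq, Equiv.Perm.mul_apply]
    exact (Equiv.swap_apply_left _ _).symm

theorem youngSubgroupHom_apply {m n : ℕ} (p : Equiv.Perm (Fin m)) (q : Equiv.Perm (Fin n)) :
    youngSubgroupHom m n (p, q) = finSumFinEquiv.permCongr (Equiv.Perm.sumCongr p q) :=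
  rfl

theorem youngSubgroupHom_injective (m n : ℕ) : Function.Injective (youngSubgroupHom m n) :=
  (finSumFinEquiv (m := m) (n := n)).permCongrHom.injective.comp Equiv.Perm.sumCongrHom_injective

theorem range_youngSubgroupHom (r : ℕ) : (youngSubgroupHom r 1).range = stabLast r := by
  refine Subgroup.eq_of_le_of_card_ge ?_ (le_of_eq ?_)
  · rintro _ ⟨⟨p, q⟩, rfl⟩
    have hlast : Fin.last r = finSumFinEquiv (Sum.inr (0 : Fin 1)) := rfl
    rw [mem_stabLast, youngSubgroupHom_apply, hlast, Equiv.permCongr_apply,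
      Equiv.symm_apply_apply, Equiv.Perm.sumCongr_apply, Sum.map_inr, Subsingleton.elim (q 0) 0]
  · rw [card_stabLast, ← Nat.card_congr (MonoidHom.ofInjective
      (youngSubgroupHom_injective r 1)).toEquiv, Nat.card_prod, Nat.card_perm, Nat.card_perm,
      Nat.card_fin, Nat.card_fin, Nat.factorial_one, mul_one]

theorem sign_youngSubgroupHom {r : ℕ} (x : Equiv.Perm (Fin r) × Equiv.Perm (Fin 1)) :
    Equiv.Perm.sign (youngSubgroupHom r 1 x) = Equiv.Perm.sign x.1 := by
  obtain ⟨p, q⟩ := x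
  rw [youngSubgroupHom_apply, Equiv.Perm.sign_permCongr, Equiv.Perm.sign_sumCongr,
    Subsingleton.elim q 1, Equiv.Perm.sign_one, mul_one]

section

variable (𝕜 : Type*) [RCLike 𝕜] (r : ℕ)

theorem eSym_eq_charIdem : eSym 𝕜 r = charIdem 𝕜 1 (stabLast r) := by
  classical
  rw [eSym, charIdem, card_stabLast]
  congr 1
  refine Finset.sum_congr (by ext; simp) fun p _ => ?_
  simp

theorem eAlt_eq_charIdem : eAlt 𝕜 r = charIdem 𝕜 Equiv.Perm.sign (stabLast r) := by
  classical
  rw [eAlt, charIdem, card_stabLast]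
  congr 1
  exact Finset.sum_congr (by ext; simp) fun p _ => rfl

theorem sum_character_smul_grp {n : ℕ} (χ : Equiv.Perm (Fin n) →* ℤˣ) :
    ∑ p, ((χ p : ℤ) : 𝕜) • grp 𝕜 p = (n.factorial : 𝕜) • charIdem 𝕜 χ ⊤ := by
  classical
  have hcard : Nat.card (⊤ : Subgroup (Equiv.Perm (Fin n))) = n.factorial := by
    rw [Subgroup.card_top, Nat.card_perm, Nat.card_fin]
  rw [charIdem, hcard, smul_inv_smul₀ (Nat.cast_ne_zero.2 n.factorial_ne_zero)]
  simp

theorem fSym_eq_charIdem : fSym 𝕜 r = charIdem 𝕜 1 ⊤ := by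
  have h := sum_character_smul_grp 𝕜 (1 : Equiv.Perm (Fin (r + 1)) →* ℤˣ)
  rw [fSym, ← inv_smul_smul₀ (Nat.cast_ne_zero.2 (r + 1).factorial_ne_zero : _ ≠ (0 : 𝕜))
    (charIdem 𝕜 1 ⊤), ← h]
  simp

theorem fAlt_eq_charIdem : fAlt 𝕜 r = charIdem 𝕜 Equiv.Perm.sign ⊤ := by
  rw [fAlt, sum_character_smul_grp,
    inv_smul_smul₀ (Nat.cast_ne_zero.2 (r + 1).factorial_ne_zero)]

theorem youngSymmetrizer_rowPartition_eq {n : ℕ} (t : Tableau (rowPartition n)) :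
    youngSymmetrizer 𝕜 t = (n.factorial : 𝕜) • charIdem 𝕜 1 ⊤ := by
  rw [youngSymmetrizer_rowPartition, ← sum_character_smul_grp]
  simp

theorem youngSymmetrizer_colPartition_eq {n : ℕ} (t : Tableau (colPartition n)) :
    youngSymmetrizer 𝕜 t = (n.factorial : 𝕜) • charIdem 𝕜 Equiv.Perm.sign ⊤ := by
  rw [youngSymmetrizer_colPartition, ← sum_character_smul_grp]

variable {𝕜 r}

/-- The stabilizers of `b` and of the last point are conjugate. -/
theorem sum_fixing_eq_conj (χ : Equiv.Perm (Fin (r + 1)) →* ℤˣ) (b : Fin (r + 1)) :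
    ∑ p : Equiv.Perm (Fin (r + 1)) with p b = b, ((χ p : ℤ) : 𝕜) • grp 𝕜 p =
      (r.factorial : 𝕜) • (grp 𝕜 (Equiv.swap b (Fin.last r)) * charIdem 𝕜 χ (stabLast r) *
        grp 𝕜 (Equiv.swap b (Fin.last r))) := by
  classical
  set g := Equiv.swap b (Fin.last r)
  have hgg : g * g = 1 := Equiv.swap_mul_self _ _
  rw [charIdem, card_stabLast, mul_smul_comm, smul_mul_assoc,
    smul_inv_smul₀ (Nat.cast_ne_zero.2 r.factorial_ne_zero), Finset.mul_sum, Finset.sum_mul]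
  symm
  have hconj : ∀ p, MulAut.conj g p = g * p * g := fun p => by
    rw [MulAut.conj_apply, inv_eq_of_mul_eq_one_left hgg]
  refine Finset.sum_equiv (MulAut.conj g).toEquiv (fun p => ?_) (fun p _ => ?_)
  · have hb : g b = Fin.last r := Equiv.swap_apply_left _ _
    have hl : g (Fin.last r) = b := Equiv.swap_apply_right _ _
    simp only [Finset.mem_filter, Finset.mem_univ, true_and]
    change p (Fin.last r) = Fin.last r ↔ (MulAut.conj g p) b = b
    rw [hconj, Equiv.Perm.mul_apply, Equiv.Perm.mul_apply, hb, ← g.injective.eq_iff, hl]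
  · change _ = ((χ (MulAut.conj g p) : ℤ) : 𝕜) • grp 𝕜 (MulAut.conj g p)
    have hχ : χ (g * p * g) = χ p := by
      rw [map_mul, map_mul, mul_comm, ← mul_assoc, ← map_mul, hgg, map_one, one_mul]
    rw [hconj, hχ, grp_mul, grp_mul, mul_smul_comm, smul_mul_assoc]

/-! ### The decomposition attached to a sign character -/

/-- To identify a minimal left ideal `A h` with `A y_t`, it suffices to factor `y_t` through `A h`. -/
theorem affords_of_factor {n : ℕ} {h : GroupRing 𝕜 n} (hh : IsAtom (leftIdeal h))
    {μ : n.Partition}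
    (hμ : ∀ t : Tableau μ, ∃ w ∈ leftIdeal h, ∃ z, youngSymmetrizer 𝕜 t = w * z) :
    Affords (idealRep (leftIdeal h)) μ := by
  intro t
  obtain ⟨w, hw, z, hwz⟩ := hμ t
  obtain ⟨φ⟩ := nonempty_linearEquiv_span_mul hh hw (hwz ▸ youngSymmetrizer_ne_zero t)
  rw [← hwz] at φ
  exact ⟨idealRepEquiv φ⟩

theorem grp_mul_eq_of_equiv {n : ℕ} {f h : GroupRing 𝕜 n} {c : Equiv.Perm (Fin n) → 𝕜}
    (hf : ∀ g x, idealRep (leftIdeal f) g x = c g • x)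
    (φ : (idealRep (leftIdeal h)).Equiv (idealRep (leftIdeal f))) (g : Equiv.Perm (Fin n)) :
    grp 𝕜 g * h = c g • h := by
  let x : (leftIdeal h).restrictScalars 𝕜 := ⟨h, Ideal.mem_span_singleton_self h⟩
  have h1 : φ.toLinearEquiv (idealRep (leftIdeal h) g x) = φ.toLinearEquiv (c g • x) := by
    rw [map_smul, ← hf]
    exact LinearMap.congr_fun (φ.isIntertwining' g) x
  have h2 := congrArg Subtype.val (φ.toLinearEquiv.injective h1)
  rwa [coe_idealRep_apply] at h2

instance {n : ℕ} : IsSemisimpleRing (GroupRing 𝕜 n) := by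
  have : NeZero (Nat.card (Equiv.Perm (Fin n)) : 𝕜) := ⟨Nat.cast_ne_zero.2 Nat.card_pos.ne'⟩
  infer_instance

/-- The other order of the summands is excluded by the action of the group: if `A h` afforded `[μ]`
like `A f`, the group would act on `h` through `χ`, giving `f h = h`, whereas `f h = 0`. -/
theorem decomposition_charIdem {n : ℕ} (χ : Equiv.Perm (Fin n) →* ℤˣ) {e h : GroupRing 𝕜 n}
    {μ ν : n.Partition} (H : SplitsCorner 𝕜 e (charIdem 𝕜 χ ⊤) h)
    (hμ : ∀ t : Tableau μ, ∃ w ∈ leftIdeal (charIdem 𝕜 χ ⊤), ∃ z, youngSymmetrizer 𝕜 t = w * z)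
    (hν : ∀ t : Tableau ν, ∃ w ∈ leftIdeal h, ∃ z, youngSymmetrizer 𝕜 t = w * z) :
    IsDecomposition e (charIdem 𝕜 χ ⊤) h μ ν ∧ IsAtom (leftIdeal (charIdem 𝕜 χ ⊤)) ∧
      IsAtom (leftIdeal h) ∧
      (∀ f' h' : GroupRing 𝕜 n, IsDecomposition e f' h' μ ν → f' = charIdem 𝕜 χ ⊤ ∧ h' = h) ∧
      OnlyPrimitiveDecomposition e (charIdem 𝕜 χ ⊤) h := by
  set f := charIdem 𝕜 χ (⊤ : Subgroup (Equiv.Perm (Fin n)))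
  have hfa := H.primitive_left.isAtom_span
  have hha := H.primitive_right.isAtom_span
  have hfμ := affords_of_factor hfa hμ
  refine ⟨⟨H.primitive_left, H.primitive_right, H.mul_eq_zero, H.mul_eq_zero', H.eq_add, hfμ,
    affords_of_factor hha hν⟩, hfa, hha, fun f' h' D => ?_, H.onlyPrimitiveDecomposition⟩
  have hff' : f' * f' = f' := D.primitive_left.2.1
  have hef : e * f' = f' := by rw [D.eq_add, add_mul, hff', D.mul_eq_zero', add_zero]
  have hfe : f' * e = f' := by rw [D.eq_add, mul_add, hff', D.mul_eq_zero, add_zero]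
  rcases H.eq_of_primitive D.primitive_left hef hfe with h1 | h1
  · refine ⟨h1, ?_⟩
    have := H.eq_add.symm.trans D.eq_add
    rw [h1] at this
    exact (add_left_cancel this).symm
  · exfalso
    obtain ⟨t⟩ := (inferInstance : Nonempty (Tableau μ))
    obtain ⟨φ⟩ := D.affords_left t
    obtain ⟨ψ⟩ := hfμ t
    have hχ := (exists_linearEquiv_of_grp_mul H.left_ne_zero
      fun g => of_mul_charIdem χ (Subgroup.mem_top g)).2
    have hfix : f * f' = f' :=
      charIdem_mul_eq χ fun g _ => grp_mul_eq_of_equiv hχ (φ.trans ψ.symm) g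
    rw [h1, H.mul_eq_zero] at hfix
    exact H.right_ne_zero hfix.symm

/-- If `χ` restricts to `c` on the factor `S_r` of `S_r × S_1`, and `S_r` acts on the Young
symmetrizers of `μ` through `c`, then inducing `[μ] ⊗ [1]` gives the left ideal of the idempotent
of `χ` on `S_r`. -/
theorem affordsProduct_charIdem (χ : Equiv.Perm (Fin (r + 1)) →* ℤˣ) {μ : r.Partition}
    {c : Equiv.Perm (Fin r) → 𝕜}
    (hμ : ∀ (t : Tableau μ) g, grp 𝕜 g * youngSymmetrizer 𝕜 t = c g • youngSymmetrizer 𝕜 t)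
    (hχ : ∀ x, ((χ (youngSubgroupHom r 1 x) : ℤ) : 𝕜) = c x.1) :
    AffordsProduct (idealRep (leftIdeal (charIdem 𝕜 χ (stabLast r)))) μ (rowPartition 1) := by
  intro t u
  obtain ⟨⟨ℓ⟩, ht⟩ := exists_linearEquiv_of_grp_mul (youngSymmetrizer_ne_zero t) (hμ t)
  obtain ⟨⟨ℓ'⟩, hu⟩ := exists_linearEquiv_of_grp_mul (c := fun _ => (1 : 𝕜))
    (youngSymmetrizer_ne_zero u) fun g => by
      rw [Subsingleton.elim g 1, grp, map_one, one_mul, one_smul]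
  rw [← range_youngSubgroupHom]
  refine nonempty_equiv_ind _ χ ((TensorProduct.congr ℓ ℓ').trans (TensorProduct.lid 𝕜 𝕜))
    fun x v => ?_
  rw [hχ]
  induction v using TensorProduct.induction_on with
  | zero => rw [map_zero, smul_zero]
  | add v w hv hw => rw [map_add, hv, hw, smul_add]
  | tmul v w =>
    change youngRep 𝕜 t x.1 v ⊗ₜ[𝕜] youngRep 𝕜 u x.2 w = c x.1 • (v ⊗ₜ[𝕜] w)
    rw [ht, hu, one_smul, TensorProduct.smul_tmul']

theorem productDecomposes_of_isDecomposition {m n : ℕ} {e f h : GroupRing 𝕜 (m + n)}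
    {μ : m.Partition} {ν : n.Partition} {α β : (m + n).Partition}
    (hprod : AffordsProduct (idealRep (leftIdeal e)) μ ν) (D : IsDecomposition e f h α β) :
    ProductDecomposes 𝕜 μ ν α β := by
  intro t u t' u'
  obtain ⟨φ⟩ := hprod t u
  obtain ⟨ψ⟩ := nonempty_equiv_prod D.primitive_left.2.1 D.primitive_right.2.1 D.mul_eq_zero
    D.mul_eq_zero' D.eq_add
  obtain ⟨φ₁⟩ := D.affords_left t'
  obtain ⟨φ₂⟩ := D.affords_right u'
  exact ⟨(φ.symm.trans ψ).trans (prodEquiv φ₁ φ₂)⟩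

/-- The element `1 - (a b)` kills the component of the symmetrizer along `f`. -/
theorem exists_rowHook_factor {e f h : GroupRing 𝕜 (r + 1)} (he : e = charIdem 𝕜 1 (stabLast r))
    (hf : f = charIdem 𝕜 1 ⊤) (heq : e = f + h) (hr : 1 ≤ r) (t : Tableau (rowHook r)) :
    ∃ w ∈ leftIdeal h, ∃ z, youngSymmetrizer 𝕜 t = w * z := by
  obtain ⟨a, b, -, hy⟩ := exists_youngSymmetrizer_rowHook 𝕜 hr t
  have hsum := sum_fixing_eq_conj (𝕜 := 𝕜) (1 : Equiv.Perm (Fin (r + 1)) →* ℤˣ) b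
  simp only [MonoidHom.one_apply, Units.val_one, Int.cast_one, one_smul] at hsum
  set g := Equiv.swap b (Fin.last r)
  have hfg : ∀ p, f * grp 𝕜 p = f := fun p => by
    rw [hf, grp, charIdem_mul_of 1 (Subgroup.mem_top p), MonoidHom.one_apply, Units.val_one,
      Int.cast_one, one_smul]
  refine ⟨(r.factorial : 𝕜) • grp 𝕜 g * h,
    Ideal.mul_mem_left _ _ (Ideal.mem_span_singleton_self h), grp 𝕜 g *
      (1 - grp 𝕜 (Equiv.swap a b)), ?_⟩
  have hkill : f * (grp 𝕜 g * (1 - grp 𝕜 (Equiv.swap a b))) = 0 := by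
    rw [← mul_assoc, hfg, mul_sub, mul_one, hfg, sub_self]
  rw [hy, hsum, ← he, heq, smul_mul_assoc, smul_mul_assoc, smul_mul_assoc, mul_assoc, mul_assoc,
    mul_assoc, add_mul, hkill, zero_add]

/-- The element `1 + (a b)` kills the component of the antisymmetrizer along `f`. -/
theorem exists_colHook_factor {e f h : GroupRing 𝕜 (r + 1)}
    (he : e = charIdem 𝕜 Equiv.Perm.sign (stabLast r)) (hf : f = charIdem 𝕜 Equiv.Perm.sign ⊤)
    (heq : e = f + h) (hr : 1 ≤ r) (t : Tableau (colHook r hr)) :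
    ∃ w ∈ leftIdeal h, ∃ z, youngSymmetrizer 𝕜 t = w * z := by
  obtain ⟨a, b, hab, hy⟩ := exists_youngSymmetrizer_colHook 𝕜 hr t
  rw [sum_fixing_eq_conj (𝕜 := 𝕜) Equiv.Perm.sign b, ← he] at hy
  set g := Equiv.swap b (Fin.last r)
  have hgf : ∀ p, grp 𝕜 p * f = sgn 𝕜 p • f := fun p => by
    rw [hf]
    exact of_mul_charIdem Equiv.Perm.sign (Subgroup.mem_top p)
  refine ⟨(r.factorial : 𝕜) • ((1 + grp 𝕜 (Equiv.swap a b)) * grp 𝕜 g) * h,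
    Ideal.mul_mem_left _ _ (Ideal.mem_span_singleton_self h), grp 𝕜 g, ?_⟩
  have hkill : (1 + grp 𝕜 (Equiv.swap a b)) * grp 𝕜 g * f = 0 := by
    rw [mul_assoc, hgf, mul_smul_comm, add_mul, one_mul, hgf, sgn_swap 𝕜 hab, neg_one_smul,
      add_neg_cancel, smul_zero]
  rw [hy, mul_smul_comm, smul_mul_assoc, smul_mul_assoc, ← mul_assoc, ← mul_assoc, heq, mul_add,
    hkill, zero_add]

end

end SymClass

theorem mainTheorem2 {𝕜 : Type*} [RCLike 𝕜] (r : ℕ) (hr : 2 ≤ r) :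
    -- the symmetric case
    (SymClass.AffordsProduct (SymClass.idealRep (SymClass.leftIdeal (SymClass.eSym 𝕜 r)))
        (SymClass.rowPartition r) (SymClass.rowPartition 1) ∧
      SymClass.ProductDecomposes 𝕜 (SymClass.rowPartition r) (SymClass.rowPartition 1)
        (SymClass.rowPartition (r + 1)) (SymClass.rowHook r) ∧
      ∃ h : SymClass.GroupRing 𝕜 (r + 1),
        SymClass.IsDecomposition (SymClass.eSym 𝕜 r) (SymClass.fSym 𝕜 r) h
          (SymClass.rowPartition (r + 1)) (SymClass.rowHook r) ∧
        IsAtom (SymClass.leftIdeal (SymClass.fSym 𝕜 r)) ∧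
        IsAtom (SymClass.leftIdeal h) ∧
        (∀ f' h' : SymClass.GroupRing 𝕜 (r + 1),
          SymClass.IsDecomposition (SymClass.eSym 𝕜 r) f' h'
            (SymClass.rowPartition (r + 1)) (SymClass.rowHook r) →
          f' = SymClass.fSym 𝕜 r ∧ h' = h) ∧
        SymClass.OnlyPrimitiveDecomposition (SymClass.eSym 𝕜 r) (SymClass.fSym 𝕜 r) h) ∧
    -- the alternating case
    (SymClass.AffordsProduct (SymClass.idealRep (SymClass.leftIdeal (SymClass.eAlt 𝕜 r)))
        (SymClass.colPartition r) (SymClass.rowPartition 1) ∧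
      SymClass.ProductDecomposes 𝕜 (SymClass.colPartition r) (SymClass.rowPartition 1)
        (SymClass.colPartition (r + 1)) (SymClass.colHook r (Nat.le_of_succ_le hr)) ∧
      ∃ h : SymClass.GroupRing 𝕜 (r + 1),
        SymClass.IsDecomposition (SymClass.eAlt 𝕜 r) (SymClass.fAlt 𝕜 r) h
          (SymClass.colPartition (r + 1)) (SymClass.colHook r (Nat.le_of_succ_le hr)) ∧
        IsAtom (SymClass.leftIdeal (SymClass.fAlt 𝕜 r)) ∧
        IsAtom (SymClass.leftIdeal h) ∧
        (∀ f' h' : SymClass.GroupRing 𝕜 (r + 1),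
          SymClass.IsDecomposition (SymClass.eAlt 𝕜 r) f' h'
            (SymClass.colPartition (r + 1)) (SymClass.colHook r (Nat.le_of_succ_le hr)) →
          f' = SymClass.fAlt 𝕜 r ∧ h' = h) ∧
        SymClass.OnlyPrimitiveDecomposition (SymClass.eAlt 𝕜 r) (SymClass.fAlt 𝕜 r) h) := by
  open SymClass in
  have hr1 : 1 ≤ r := Nat.le_of_succ_le hr
  have hmem : ∀ {f y : GroupRing 𝕜 (r + 1)} {c : 𝕜}, y = c • f → ∃ w ∈ leftIdeal f, ∃ z, y = w * z :=
    fun {f y c} h => ⟨f, Ideal.mem_span_singleton_self f, c • 1, by rw [h, mul_smul_comm, mul_one]⟩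
  constructor
  · rw [eSym_eq_charIdem, fSym_eq_charIdem]
    have H := splitsCorner_charIdem (k := 𝕜) (1 : Equiv.Perm (Fin (r + 1)) →* ℤˣ)
      (stabLast_ne_top hr1) exists_eq_mul_mul_of_notMem_stabLast
    have D := decomposition_charIdem (μ := rowPartition (r + 1)) (ν := rowHook r) 1 H
      (fun t => hmem (youngSymmetrizer_rowPartition_eq 𝕜 t))
      (exists_rowHook_factor rfl rfl H.eq_add hr1)
    have P : AffordsProduct (idealRep (leftIdeal (charIdem 𝕜 1 (stabLast r)))) (rowPartition r)
        (rowPartition 1) := by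
      refine affordsProduct_charIdem (c := fun _ => 1) 1 (fun t g => ?_) (fun x => by simp)
      rw [youngSymmetrizer_rowPartition_eq, mul_smul_comm, grp,
        of_mul_charIdem 1 (Subgroup.mem_top g)]
      simp
    exact ⟨P, productDecomposes_of_isDecomposition P D.1, _, D⟩
  · rw [eAlt_eq_charIdem, fAlt_eq_charIdem]
    have H := splitsCorner_charIdem (k := 𝕜) (Equiv.Perm.sign (α := Fin (r + 1)))
      (stabLast_ne_top hr1) exists_eq_mul_mul_of_notMem_stabLast
    have D := decomposition_charIdem (μ := colPartition (r + 1)) (ν := colHook r hr1) _ H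
      (fun t => hmem (youngSymmetrizer_colPartition_eq 𝕜 t))
      (exists_colHook_factor rfl rfl H.eq_add hr1)
    have P : AffordsProduct (idealRep (leftIdeal (charIdem 𝕜 Equiv.Perm.sign (stabLast r))))
        (colPartition r) (rowPartition 1) := by
      refine affordsProduct_charIdem (c := fun p => sgn 𝕜 p) _ (fun t g => ?_)
        (fun x => by rw [sign_youngSubgroupHom])
      rw [youngSymmetrizer_colPartition_eq, mul_smul_comm, grp,
        of_mul_charIdem _ (Subgroup.mem_top g), smul_comm]
    exact ⟨P, productDecomposes_of_isDecomposition P D.1, _, D⟩
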